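/- Let $V$ be a complex vector space with a nonzero vector $\mathbb 1$, let $\mathrm{Aut}(V,\mathbb 1)$ be the group of linear automorphisms of $V$ fixing $\mathbb 1$, and let $V=\mathbb C\mathbb 1\oplus U$ be a splitting, so that $\mathrm{Aut}(V,\mathbb 1)\cong GL(U)\ltimes U^*$. Let $\lambda$ be a partition; for $n\ge|\lambda|+\lambda_1$ put $\tilde\lambda(n)=(n-|\lambda|,\lambda_1,\lambda_2,\dots)$. Let $\mathbb S^\mu$ denote the Schur functor of $\mu$ (the image of the Young symmetrizer $c_\mu$ on $V^{\otimes|\mu|}$), let $\phi_{\lambda,n}:\mathbb S^{\tilde\lambda(n)}V\to\mathbb S^{\tilde\lambda(n+1)}V$ be the map obtained from the natural projection $\mathbb S^{\tilde\lambda(n)}V\otimes V\to\mathbb S^{\tilde\lambda(n+1)}V$, $c_{\tilde\lambda(n)}t\otimes v\mapsto c_{\tilde\lambda(n+1)}(t\otimes v)$ (the last factor being placed at the new cell of the first row), by setting the second argument equal to $\mathbb 1$, and let $\mathbb S^{\lambda,\infty}V=\varinjlim_n\mathbb S^{\tilde\lambda(n)}V$ be the direct limit along the $\phi_{\lambda,n}$.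 Let $E_\lambda=\mathrm{Ind}_{GL(U)}^{GL(U)\ltimes U^*}\mathbb S^\lambda U=SU\otimes\mathbb S^\lambda U$, where $GL(U)$ acts in the obvious way and $\xi\in U^*$ acts on the first factor by $\exp(\partial_\xi)$, i.e. by the algebra automorphism $u\mapsto u+\xi(u)$ of $SU$. Then: (1) If $\lambda$ has at most $\dim V-1$ parts, then for every $n\ge|\lambda|+\lambda_1$ there is a nonzero $\mathrm{Aut}(V,\mathbb 1)$-homomorphism $\mathbb S^{\tilde\lambda(n)}V\to E_\lambda$, and it is unique up to scaling. (For any $\lambda$,) every nonzero $\mathrm{Aut}(V,\mathbb 1)$-homomorphism $\mathbb S^{\tilde\lambda(n)}V\to E_\lambda$ is injective. (2) The maps $\phi_{\lambda,n}$, $n\ge|\lambda|+\lambda_1$, are injective. (3) For every $n\ge|\lambda|+\lambda_1$ there is exactly one $\mathrm{Aut}(V,\mathbb 1)$-homomorphism $f_{\lambda,n}:\mathbb S^{\tilde\lambda(n)}V\to E_\lambda$ with $f_{\lambda,n}\bigl(c_{\tilde\lambda(n)}(\mathbb 1^{\otimes(n-|\lambda|)}\otimes w)\bigr)=1\otimes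 c_\lambda w$ for all $w\in U^{\otimes|\lambda|}$ (with the vectors $\mathbb 1$ placed in the first row). It is injective, and $f_{\lambda,n+1}\circ\phi_{\lambda,n}=f_{\lambda,n}$. The induced map $\varinjlim f_{\lambda,n}:\mathbb S^{\lambda,\infty}V\to E_\lambda$ is an isomorphism of representations of $\mathrm{Aut}(V,\mathbb 1)$, and every $\mathrm{Aut}(V,\mathbb 1)$-homomorphism $\mathbb S^{\lambda,\infty}V\to E_\lambda$ is a scalar multiple of it. (4) Consequently $E_\lambda$ does not depend on the splitting: for any other splitting $V=\mathbb C\mathbb 1\oplus U'$, the representations $E_\lambda$ constructed from $U$ and from $U'$ are isomorphic, by an isomorphism compatible with the canonical isomorphisms of (3) with $\mathbb S^{\lambda,\infty}V$. -/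

import Mathlib

open scoped TensorProduct

noncomputable section

namespace UnitalSchur

/-! ## Schur functors through Young symmetrizers -/

section Schur

variable (μ : YoungDiagram) (W : Type*) [AddCommGroup W] [Module ℂ W]
variable {W' W'' : Type*} [AddCommGroup W'] [Module ℂ W'] [AddCommGroup W''] [Module ℂ W'']

/-- The tensor power `W^{⊗ |μ|}`, with one tensor factor for each cell of `μ`. -/
abbrev Tens : Type _ := ⨂[ℂ] _ : μ.cells, W

/-- Permutation of the tensor factors: the left action of the symmetric group of the set of
cells on `W^{⊗ |μ|}`. -/
def permT (σ : Equiv.Perm μ.cells) : Tens μ W →ₗ[ℂ] Tens μ W :=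
  (PiTensorProduct.reindex ℂ (fun _ : μ.cells => W) σ).toLinearMap

/-- The permutations of the cells that preserve every row. -/
def rowGroup : Finset (Equiv.Perm μ.cells) :=
  {σ | ∀ c, (σ c).1.1 = c.1.1}

/-- The permutations of the cells that preserve every column. -/
def colGroup : Finset (Equiv.Perm μ.cells) :=
  {σ | ∀ c, (σ c).1.2 = c.1.2}

/-- The row symmetrizer `a_μ = ∑ σ`, over the row group. -/
def rowSym : Tens μ W →ₗ[ℂ] Tens μ W := ∑ σ ∈ rowGroup μ, permT μ W σ

/-- The column antisymmetrizer `b_μ = ∑ sign(σ) σ`, over the column group. -/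
def colAnti : Tens μ W →ₗ[ℂ] Tens μ W :=
  ∑ σ ∈ colGroup μ, ((Equiv.Perm.sign σ : ℤ) : ℂ) • permT μ W σ

/-- The Young symmetrizer `c_μ = a_μ b_μ` acting on `W^{⊗ |μ|}`. -/
def youngSym : Tens μ W →ₗ[ℂ] Tens μ W := rowSym μ W ∘ₗ colAnti μ W

/-- The Schur functor `𝕊^μ W`: the image of the Young symmetrizer in `W^{⊗ |μ|}`. -/
def schur : Submodule ℂ (Tens μ W) := LinearMap.range (youngSym μ W)

variable {W}

/-- The surjection `c_μ : W^{⊗ |μ|} → 𝕊^μ W`. -/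
def schurMk : Tens μ W →ₗ[ℂ] schur μ W := (youngSym μ W).rangeRestrict

lemma schurMk_coe (t : Tens μ W) : (schurMk μ t : Tens μ W) = youngSym μ W t := rfl

lemma schurMk_surjective : Function.Surjective (schurMk μ (W := W)) :=
  LinearMap.surjective_rangeRestrict _

/-- `f ↦ f^{⊗ |μ|}`. -/
def tensMap (f : W →ₗ[ℂ] W') : Tens μ W →ₗ[ℂ] Tens μ W' := PiTensorProduct.map fun _ => f

@[simp] lemma permT_tprod (σ : Equiv.Perm μ.cells) (x : μ.cells → W) :
    permT μ W σ (PiTensorProduct.tprod ℂ x) = PiTensorProduct.tprod ℂ fun c => x (σ.symm c) :=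
  PiTensorProduct.reindex_tprod _ _

@[simp] lemma tensMap_tprod (f : W →ₗ[ℂ] W') (x : μ.cells → W) :
    tensMap μ f (PiTensorProduct.tprod ℂ x) = PiTensorProduct.tprod ℂ fun c => f (x c) :=
  PiTensorProduct.map_tprod _ _

lemma permT_mul (σ τ : Equiv.Perm μ.cells) (t : Tens μ W) :
    permT μ W (σ * τ) t = permT μ W σ (permT μ W τ t) := by
  have : permT μ W (σ * τ) = permT μ W σ ∘ₗ permT μ W τ := by
    apply PiTensorProduct.ext
    ext x
    simp [Equiv.Perm.mul_def]
  rw [this, LinearMap.comp_apply]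

lemma tensMap_permT (f : W →ₗ[ℂ] W') (σ : Equiv.Perm μ.cells) (t : Tens μ W) :
    tensMap μ f (permT μ W σ t) = permT μ W' σ (tensMap μ f t) := by
  have : tensMap μ f ∘ₗ permT μ W σ = permT μ W' σ ∘ₗ tensMap μ f := by
    apply PiTensorProduct.ext
    ext x
    simp
  exact LinearMap.congr_fun this t

lemma tensMap_rowSym (f : W →ₗ[ℂ] W') (t : Tens μ W) :
    tensMap μ f (rowSym μ W t) = rowSym μ W' (tensMap μ f t) := by
  simp [rowSym, LinearMap.sum_apply, map_sum, tensMap_permT]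

lemma tensMap_colAnti (f : W →ₗ[ℂ] W') (t : Tens μ W) :
    tensMap μ f (colAnti μ W t) = colAnti μ W' (tensMap μ f t) := by
  simp [colAnti, LinearMap.sum_apply, map_sum, tensMap_permT]

lemma tensMap_youngSym (f : W →ₗ[ℂ] W') (t : Tens μ W) :
    tensMap μ f (youngSym μ W t) = youngSym μ W' (tensMap μ f t) := by
  simp [youngSym, tensMap_rowSym, tensMap_colAnti]

lemma tensMap_id : tensMap μ (LinearMap.id : W →ₗ[ℂ] W) = LinearMap.id :=
  PiTensorProduct.map_id

lemma tensMap_comp (g : W' →ₗ[ℂ] W'') (f : W →ₗ[ℂ] W') :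
    tensMap μ (g ∘ₗ f) = tensMap μ g ∘ₗ tensMap μ f :=
  PiTensorProduct.map_comp _ _

/-- Functoriality of `𝕊^μ`: the restriction of `f^{⊗ |μ|}`. -/
def schurMap (f : W →ₗ[ℂ] W') : schur μ W →ₗ[ℂ] schur μ W' :=
  (tensMap μ f).restrict fun x hx => by
    obtain ⟨t, rfl⟩ := hx
    exact ⟨tensMap μ f t, (tensMap_youngSym μ f t).symm⟩

lemma schurMap_coe (f : W →ₗ[ℂ] W') (x : schur μ W) :
    (schurMap μ f x : Tens μ W') = tensMap μ f x := rfl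

lemma schurMap_id : schurMap μ (LinearMap.id : W →ₗ[ℂ] W) = LinearMap.id := by
  ext x
  simp [schurMap_coe, tensMap_id]

lemma schurMap_comp (g : W' →ₗ[ℂ] W'') (f : W →ₗ[ℂ] W') :
    schurMap μ (g ∘ₗ f) = schurMap μ g ∘ₗ schurMap μ f := by
  ext x
  simp [schurMap_coe, tensMap_comp]

end Schur

/-! ## The diagrams `λ̃(n) = (n - |λ|, λ₁, λ₂, …)` -/

section Diagram

variable (lam : YoungDiagram)

/-- The Young diagram `λ̃(n) = (n - |λ|, λ₁, λ₂, …)`, for `n ≥ |λ| + λ₁`. -/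
def tilde (n : ℕ) (h : lam.card + lam.rowLen 0 ≤ n) : YoungDiagram where
  cells := (Finset.range (n - lam.card)).image (fun j => (0, j)) ∪
    lam.cells.image (fun c => (c.1 + 1, c.2))
  isLowerSet := by
    have key : ∀ i j, (i, j) ∈ lam → j < n - lam.card := by
      intro i j hij
      have h0 : (0, j) ∈ lam := lam.up_left_mem (Nat.zero_le i) le_rfl hij
      rw [YoungDiagram.mem_iff_lt_rowLen] at h0
      omega
    rintro ⟨i, j⟩ ⟨i', j'⟩ hle hc
    obtain ⟨hi, hj⟩ : i' ≤ i ∧ j' ≤ j := hle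
    simp only [Finset.coe_union, Finset.coe_image, Set.mem_union, Set.mem_image, Finset.mem_coe,
      Finset.mem_range, Prod.mk.injEq, Prod.exists, YoungDiagram.mem_cells] at hc ⊢
    rcases hc with ⟨a, ha, rfl, rfl⟩ | ⟨a, b, hab, rfl, rfl⟩
    · exact Or.inl ⟨j', by omega, by omega, rfl⟩
    · rcases i' with _ | i'
      · exact Or.inl ⟨j', lt_of_le_of_lt hj (key _ _ hab), rfl, rfl⟩
      · exact Or.inr ⟨i', j', lam.up_left_mem (by omega) hj hab, rfl, rfl⟩

variable {lam} {n : ℕ}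

lemma zero_mem_tilde {h : lam.card + lam.rowLen 0 ≤ n} {j : ℕ} :
    (0, j) ∈ (tilde lam n h).cells ↔ j < n - lam.card := by
  simp [tilde]

lemma succ_mem_tilde {h : lam.card + lam.rowLen 0 ≤ n} {i j : ℕ} :
    (i + 1, j) ∈ (tilde lam n h).cells ↔ (i, j) ∈ lam.cells := by
  simp [tilde]

lemma tilde_mono (h : lam.card + lam.rowLen 0 ≤ n) {c : ℕ × ℕ} (hc : c ∈ (tilde lam n h).cells) :
    c ∈ (tilde lam (n + 1) (Nat.le_succ_of_le h)).cells := by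
  obtain ⟨_ | i, j⟩ := c
  · rw [zero_mem_tilde] at hc ⊢
    omega
  · rwa [succ_mem_tilde] at hc ⊢

lemma newCell_mem (h : lam.card + lam.rowLen 0 ≤ n) :
    (0, n - lam.card) ∈ (tilde lam (n + 1) (Nat.le_succ_of_le h)).cells := by
  rw [zero_mem_tilde]
  omega

lemma newCell_col (h : lam.card + lam.rowLen 0 ≤ n) {c : ℕ × ℕ}
    (hc : c ∈ (tilde lam (n + 1) (Nat.le_succ_of_le h)).cells) (h2 : c.2 = n - lam.card) :
    c = (0, n - lam.card) := by
  obtain ⟨_ | i, j⟩ := c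
  · simp_all
  · rw [succ_mem_tilde] at hc
    have h0 : (0, j) ∈ lam := lam.up_left_mem (Nat.zero_le i) le_rfl hc
    rw [YoungDiagram.mem_iff_lt_rowLen] at h0
    simp only at h2
    omega

/-- `λ̃(n+1)` is `λ̃(n)` together with one more cell, at the end of row `0`. -/
def addCell (h : lam.card + lam.rowLen 0 ≤ n) :
    (tilde lam n h).cells ⊕ Unit ≃ (tilde lam (n + 1) (Nat.le_succ_of_le h)).cells :=
  Equiv.ofBijective
    (Sum.elim (fun c => ⟨c.1, tilde_mono h c.2⟩) fun _ => ⟨(0, n - lam.card), newCell_mem h⟩) <| by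
    constructor
    · rintro (⟨⟨i, j⟩, hc⟩ | _) (⟨⟨i', j'⟩, hc'⟩ | _) he
      · simpa using he
      · simp only [Sum.elim_inl, Sum.elim_inr, Subtype.mk.injEq, Prod.mk.injEq] at he
        obtain ⟨rfl, rfl⟩ := he
        rw [zero_mem_tilde] at hc
        omega
      · simp only [Sum.elim_inl, Sum.elim_inr, Subtype.mk.injEq, Prod.mk.injEq] at he
        obtain ⟨rfl, rfl⟩ := he
        rw [zero_mem_tilde] at hc'
        omega
      · rfl
    · rintro ⟨⟨_ | i, j⟩, hc⟩
      · have hj := hc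
        rw [zero_mem_tilde] at hj
        by_cases hjn : j < n - lam.card
        · exact ⟨Sum.inl ⟨(0, j), zero_mem_tilde.2 hjn⟩, rfl⟩
        · refine ⟨Sum.inr (), ?_⟩
          simp only [Sum.elim_inr, Subtype.mk.injEq, Prod.mk.injEq, true_and]
          omega
      · exact ⟨Sum.inl ⟨(i + 1, j), succ_mem_tilde.2 (succ_mem_tilde.1 hc)⟩, rfl⟩

@[simp] lemma addCell_inl (h : lam.card + lam.rowLen 0 ≤ n) (c : (tilde lam n h).cells) :
    (addCell h (Sum.inl c)).1 = c.1 := rfl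

@[simp] lemma addCell_inr (h : lam.card + lam.rowLen 0 ≤ n) (u : Unit) :
    (addCell h (Sum.inr u)).1 = (0, n - lam.card) := rfl

end Diagram

/-! ## The projection `𝕊^{λ̃(n)} V ⊗ V → 𝕊^{λ̃(n+1)} V` -/

section Projection

variable {lam : YoungDiagram} {n : ℕ} (h : lam.card + lam.rowLen 0 ≤ n)
variable {V : Type*} [AddCommGroup V] [Module ℂ V]

/-- The identification `V^{⊗ n} ⊗ V = V^{⊗ (n+1)}`, where the last factor is put at the new cell. -/
def appendT : (Tens (tilde lam n h) V ⊗[ℂ] V) →ₗ[ℂ]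
    Tens (tilde lam (n + 1) (Nat.le_succ_of_le h)) V :=
  (PiTensorProduct.reindex ℂ (fun _ => V) (addCell h)).toLinearMap ∘ₗ
    (PiTensorProduct.tmulEquiv ℂ V).toLinearMap ∘ₗ
      (PiTensorProduct.subsingletonEquiv (R := ℂ) (s := fun _ : Unit => V) ()).symm.toLinearMap.lTensor
        (Tens (tilde lam n h) V)

lemma appendT_tprod (x : (tilde lam n h).cells → V) (v : V) :
    appendT h (PiTensorProduct.tprod ℂ x ⊗ₜ v) =
      PiTensorProduct.tprod ℂ fun c => Sum.elim x (fun _ => v) ((addCell h).symm c) := by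
  simp only [appendT, LinearMap.comp_apply, LinearMap.lTensor_tmul, LinearEquiv.coe_coe,
    PiTensorProduct.subsingletonEquiv_symm_apply', PiTensorProduct.tmulEquiv_apply,
    PiTensorProduct.reindex_tprod]

/-- Extension of a permutation of the cells of `λ̃(n)` to `λ̃(n+1)`, fixing the new cell. -/
def extPerm (σ : Equiv.Perm (tilde lam n h).cells) :
    Equiv.Perm (tilde lam (n + 1) (Nat.le_succ_of_le h)).cells :=
  (addCell h).permCongr (Equiv.Perm.sumCongr σ 1)

lemma extPerm_inl (σ : Equiv.Perm (tilde lam n h).cells) (c) :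
    extPerm h σ (addCell h (Sum.inl c)) = addCell h (Sum.inl (σ c)) := by
  simp [extPerm, Equiv.permCongr_apply]

lemma extPerm_inr (σ : Equiv.Perm (tilde lam n h).cells) (u : Unit) :
    extPerm h σ (addCell h (Sum.inr u)) = addCell h (Sum.inr u) := by
  simp [extPerm, Equiv.permCongr_apply]

lemma sign_extPerm (σ : Equiv.Perm (tilde lam n h).cells) :
    Equiv.Perm.sign (extPerm h σ) = Equiv.Perm.sign σ := by
  simp [extPerm, Equiv.Perm.sign_permCongr, Equiv.Perm.sign_sumCongr]

lemma extPerm_injective : Function.Injective (extPerm h) := by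
  intro σ τ hst
  ext1 c
  have := congrArg (fun p => p (addCell h (Sum.inl c))) hst
  simpa [extPerm_inl] using this

lemma appendT_permT (σ : Equiv.Perm (tilde lam n h).cells) (t : Tens (tilde lam n h) V) (v : V) :
    appendT h (permT _ V σ t ⊗ₜ v) = permT _ V (extPerm h σ) (appendT h (t ⊗ₜ v)) := by
  have : (appendT h ∘ₗ (TensorProduct.mk ℂ _ V).flip v) ∘ₗ permT _ V σ =
      permT _ V (extPerm h σ) ∘ₗ (appendT h ∘ₗ (TensorProduct.mk ℂ _ V).flip v) := by
    apply PiTensorProduct.ext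
    ext x
    simp only [LinearMap.compMultilinearMap_apply, LinearMap.comp_apply, permT_tprod,
      LinearMap.flip_apply, TensorProduct.mk_apply, appendT_tprod]
    congr 1
    funext c
    obtain ⟨d, rfl⟩ := (addCell h).surjective c
    rcases d with d | d
    · have : (extPerm h σ).symm (addCell h (Sum.inl d)) = addCell h (Sum.inl (σ.symm d)) := by
        rw [Equiv.symm_apply_eq, extPerm_inl, Equiv.apply_symm_apply]
      rw [this]
      simp
    · have : (extPerm h σ).symm (addCell h (Sum.inr d)) = addCell h (Sum.inr d) := by
        rw [Equiv.symm_apply_eq, extPerm_inr]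
      rw [this]
      simp
  exact LinearMap.congr_fun this t

lemma extPerm_mem_rowGroup {σ : Equiv.Perm (tilde lam n h).cells} (hσ : σ ∈ rowGroup _) :
    extPerm h σ ∈ rowGroup _ := by
  simp only [rowGroup, Finset.mem_filter, Finset.mem_univ, true_and] at hσ ⊢
  intro c
  obtain ⟨d, rfl⟩ := (addCell h).surjective c
  rcases d with d | d
  · rw [extPerm_inl, addCell_inl, addCell_inl, hσ]
  · rw [extPerm_inr]

lemma extPerm_mem_colGroup {σ : Equiv.Perm (tilde lam n h).cells} (hσ : σ ∈ colGroup _) :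
    extPerm h σ ∈ colGroup _ := by
  simp only [colGroup, Finset.mem_filter, Finset.mem_univ, true_and] at hσ ⊢
  intro c
  obtain ⟨d, rfl⟩ := (addCell h).surjective c
  rcases d with d | d
  · rw [extPerm_inl, addCell_inl, addCell_inl, hσ]
  · rw [extPerm_inr]

lemma exists_extPerm_of_mem_colGroup
    {τ : Equiv.Perm (tilde lam (n + 1) (Nat.le_succ_of_le h)).cells} (hτ : τ ∈ colGroup _) :
    ∃ σ ∈ colGroup (tilde lam n h), extPerm h σ = τ := by
  simp only [colGroup, Finset.mem_filter, Finset.mem_univ, true_and] at hτ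
  have hfix : τ (addCell h (Sum.inr ())) = addCell h (Sum.inr ()) := by
    apply Subtype.ext
    rw [addCell_inr]
    exact newCell_col h (τ _).2 (by rw [hτ, addCell_inr])
  have hr : (addCell h).symm.permCongr τ ∈
      (Equiv.Perm.sumCongrHom (tilde lam n h).cells Unit).range := by
    apply Equiv.Perm.mem_sumCongrHom_range_of_perm_mapsTo_inl
    rintro _ ⟨c, rfl⟩
    rcases hd : (addCell h).symm.permCongr τ (Sum.inl c) with d | d
    · exact ⟨d, rfl⟩
    · exfalso
      rw [Equiv.permCongr_apply, Equiv.symm_symm, Equiv.symm_apply_eq] at hd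
      have := τ.injective (hd.trans hfix.symm)
      simpa using (addCell h).injective this
  obtain ⟨⟨σ, ρ⟩, hσ⟩ := hr
  have hρ : ρ = 1 := Subsingleton.elim _ _
  subst hρ
  have he : extPerm h σ = τ := by
    have h1 : Equiv.Perm.sumCongr σ 1 = (addCell h).symm.permCongr τ := hσ
    rw [extPerm, h1]
    exact (addCell h).permCongr.apply_symm_apply τ
  refine ⟨σ, ?_, he⟩
  simp only [colGroup, Finset.mem_filter, Finset.mem_univ, true_and]
  intro c
  have := hτ (addCell h (Sum.inl c))
  rwa [← he, extPerm_inl, addCell_inl, addCell_inl] at this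

lemma colAnti_appendT (t : Tens (tilde lam n h) V) (v : V) :
    colAnti _ V (appendT h (t ⊗ₜ v)) = appendT h (colAnti _ V t ⊗ₜ v) := by
  simp only [colAnti, LinearMap.sum_apply, TensorProduct.sum_tmul, map_sum, LinearMap.smul_apply,
    ← TensorProduct.smul_tmul', map_smul, appendT_permT]
  symm
  refine Finset.sum_bij (fun σ _ => extPerm h σ) (fun σ hσ => extPerm_mem_colGroup h hσ)
    (fun σ _ τ _ hst => extPerm_injective h hst) (fun τ hτ => ?_) (fun σ _ => ?_)
  · obtain ⟨σ, hσ, he⟩ := exists_extPerm_of_mem_colGroup h hτ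
    exact ⟨σ, hσ, he⟩
  · rw [sign_extPerm]

lemma rowSym_permT (μ : YoungDiagram) {τ : Equiv.Perm μ.cells} (hτ : τ ∈ rowGroup μ)
    (t : Tens μ V) : rowSym μ V (permT μ V τ t) = rowSym μ V t := by
  simp only [rowSym, LinearMap.sum_apply, ← permT_mul]
  simp only [rowGroup, Finset.mem_filter, Finset.mem_univ, true_and] at hτ
  refine Finset.sum_bij (fun σ _ => σ * τ) (fun σ hσ => ?_) (fun σ _ σ' _ he => mul_right_cancel he)
    (fun σ hσ => ⟨σ * τ⁻¹, ?_, by simp⟩) (fun σ _ => rfl)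
  · simp only [rowGroup, Finset.mem_filter, Finset.mem_univ, true_and] at hσ ⊢
    intro c
    rw [Equiv.Perm.mul_apply, hσ, hτ]
  · simp only [rowGroup, Finset.mem_filter, Finset.mem_univ, true_and] at hσ ⊢
    intro c
    have := hτ (τ⁻¹ c)
    rw [show τ (τ⁻¹ c) = c from τ.apply_symm_apply c] at this
    rw [Equiv.Perm.mul_apply, hσ, this]

lemma rowSym_appendT_youngSym (t : Tens (tilde lam n h) V) (v : V) :
    rowSym _ V (appendT h (youngSym _ V t ⊗ₜ v)) =
      ((rowGroup (tilde lam n h)).card : ℂ) • youngSym _ V (appendT h (t ⊗ₜ v)) := by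
  have key : ∀ s : Tens (tilde lam n h) V, rowSym _ V (appendT h (rowSym _ V s ⊗ₜ v)) =
      ((rowGroup (tilde lam n h)).card : ℂ) • rowSym _ V (appendT h (s ⊗ₜ v)) := by
    intro s
    rw [show rowSym (tilde lam n h) V s = ∑ σ ∈ rowGroup _, permT _ V σ s from
      LinearMap.sum_apply _ _ _, TensorProduct.sum_tmul, map_sum, map_sum]
    rw [Finset.sum_congr rfl (fun σ hσ => by
      rw [appendT_permT, rowSym_permT _ (extPerm_mem_rowGroup h hσ)]), Finset.sum_const,
      Nat.cast_smul_eq_nsmul]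
  rw [youngSym, LinearMap.comp_apply, key, youngSym, LinearMap.comp_apply, colAnti_appendT]

lemma rowGroup_card_ne_zero (μ : YoungDiagram) : ((rowGroup μ).card : ℂ) ≠ 0 := by
  have : (1 : Equiv.Perm μ.cells) ∈ rowGroup μ := by simp [rowGroup]
  exact_mod_cast Finset.card_ne_zero_of_mem this

/-- The natural projection `𝕊^{λ̃(n)} V ⊗ V → 𝕊^{λ̃(n+1)} V`: symmetrization along the rows of
`λ̃(n+1)`. It is normalized so that it sends `c t ⊗ v` to `c' (t ⊗ v)`, where `c`, `c'` are the Young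
symmetrizers of `λ̃(n)` and `λ̃(n+1)`; see `schurProj_mk`. -/
def schurProj : (schur (tilde lam n h) V ⊗[ℂ] V) →ₗ[ℂ]
    schur (tilde lam (n + 1) (Nat.le_succ_of_le h)) V :=
  LinearMap.codRestrict _
    (((rowGroup (tilde lam n h)).card : ℂ)⁻¹ •
      (rowSym _ V ∘ₗ appendT h ∘ₗ (schur (tilde lam n h) V).subtype.rTensor V)) <| by
    intro z
    induction z using TensorProduct.induction_on with
    | zero => rw [map_zero]; exact Submodule.zero_mem _
    | add a b ha hb => rw [map_add]; exact Submodule.add_mem _ ha hb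
    | tmul y v =>
      obtain ⟨_, t, rfl⟩ := y
      refine ⟨appendT h (t ⊗ₜ v), ?_⟩
      simp only [LinearMap.smul_apply, LinearMap.comp_apply, LinearMap.rTensor_tmul,
        Submodule.subtype_apply]
      rw [rowSym_appendT_youngSym, inv_smul_smul₀ (rowGroup_card_ne_zero _)]

lemma schurProj_mk (t : Tens (tilde lam n h) V) (v : V) :
    schurProj h (schurMk _ t ⊗ₜ v) = schurMk _ (appendT h (t ⊗ₜ v)) := by
  apply Subtype.ext
  change ((rowGroup (tilde lam n h)).card : ℂ)⁻¹ •
    rowSym _ V (appendT h (youngSym _ V t ⊗ₜ v)) = youngSym _ V _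
  rw [rowSym_appendT_youngSym, inv_smul_smul₀ (rowGroup_card_ne_zero _)]

lemma tensMap_appendT (f : V →ₗ[ℂ] V) (t : Tens (tilde lam n h) V) (v : V) :
    tensMap _ f (appendT h (t ⊗ₜ v)) = appendT h (tensMap _ f t ⊗ₜ f v) := by
  have : tensMap _ f ∘ₗ (appendT h ∘ₗ (TensorProduct.mk ℂ _ V).flip v) =
      (appendT h ∘ₗ (TensorProduct.mk ℂ _ V).flip (f v)) ∘ₗ tensMap _ f := by
    apply PiTensorProduct.ext
    ext x
    simp only [LinearMap.compMultilinearMap_apply, LinearMap.comp_apply, tensMap_tprod,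
      LinearMap.flip_apply, TensorProduct.mk_apply, appendT_tprod]
    congr 1
    funext c
    rcases (addCell h).symm c with d | d <;> rfl
  exact LinearMap.congr_fun this t

lemma schurMap_schurMk {W W' : Type*} [AddCommGroup W] [Module ℂ W] [AddCommGroup W'] [Module ℂ W']
    (μ : YoungDiagram) (f : W →ₗ[ℂ] W') (t : Tens μ W) :
    schurMap μ f (schurMk μ t) = schurMk μ (tensMap μ f t) :=
  Subtype.ext (tensMap_youngSym μ f t)

/-- The stabilization map `φ_{λ,n} : 𝕊^{λ̃(n)} V → 𝕊^{λ̃(n+1)} V`, obtained from the natural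
projection by setting the second argument to be the distinguished vector. -/
def stab (one : V) : schur (tilde lam n h) V →ₗ[ℂ]
    schur (tilde lam (n + 1) (Nat.le_succ_of_le h)) V :=
  schurProj h ∘ₗ (TensorProduct.mk ℂ _ V).flip one

lemma stab_mk (one : V) (t : Tens (tilde lam n h) V) :
    stab h one (schurMk _ t) = schurMk _ (appendT h (t ⊗ₜ one)) := schurProj_mk h t one

lemma schurMap_stab (one : V) (f : V →ₗ[ℂ] V) (hf : f one = one) (y : schur (tilde lam n h) V) :
    schurMap _ f (stab h one y) = stab h one (schurMap _ f y) := by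
  obtain ⟨t, rfl⟩ := schurMk_surjective _ y
  rw [stab_mk, schurMap_schurMk, tensMap_appendT, schurMap_schurMk, stab_mk, hf]

end Projection

/-! ## The group `Aut(V, 𝟙)` and its representations -/

section Aut

variable {V : Type*} [AddCommGroup V] [Module ℂ V]

/-- The group `Aut(V, 𝟙)` of linear automorphisms of `V` that fix the vector `𝟙`. -/
abbrev UAut (one : V) : Subgroup (V ≃ₗ[ℂ] V) := MulAction.stabilizer (V ≃ₗ[ℂ] V) one

/-- An element of `Aut(V, 𝟙)` as a linear endomorphism of `V`. -/
def autLin {one : V} (g : UAut one) : V →ₗ[ℂ] V := (g : V ≃ₗ[ℂ] V).toLinearMap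

lemma autLin_one {one : V} (g : UAut one) : autLin g one = one := g.2

lemma autLin_id {one : V} : autLin (1 : UAut one) = LinearMap.id := rfl

lemma autLin_mul {one : V} (g g' : UAut one) : autLin (g * g') = autLin g ∘ₗ autLin g' := rfl

/-- The representation of `Aut(V, 𝟙)` on `𝕊^μ V`. -/
def schurRep (one : V) (μ : YoungDiagram) : Representation ℂ (UAut one) (schur μ V) where
  toFun g := schurMap μ (autLin g)
  map_one' := by rw [autLin_id, schurMap_id]; rfl
  map_mul' g g' := by rw [autLin_mul, schurMap_comp]; rfl

/-! ### The limit `𝕊^{λ,∞} V` -/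

variable (one : V) (lam : YoungDiagram)

lemma level_le (k : ℕ) : lam.card + lam.rowLen 0 ≤ lam.card + lam.rowLen 0 + k :=
  Nat.le_add_right _ _

variable (V) in
/-- The spaces `𝕊^{λ̃(n)} V`, `n = |λ| + λ₁ + k`, `k = 0, 1, 2, …` -/
abbrev level (k : ℕ) : Type _ := schur (tilde lam _ (level_le lam k)) V

/-- The map `φ_{λ,n}` for `n = |λ| + λ₁ + k`. -/
def levelStep (k : ℕ) : level V lam k →ₗ[ℂ] level V lam (k + 1) := stab (level_le lam k) one

/-- The composite of the maps `φ_{λ,n}` from level `i` to level `j`. -/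
def levelMap (i j : ℕ) (hij : i ≤ j) : level V lam i →ₗ[ℂ] level V lam j :=
  Nat.leRecOn (C := fun m => level V lam i →ₗ[ℂ] level V lam m) hij
    (fun {m} F => levelStep one lam m ∘ₗ F) LinearMap.id

lemma levelMap_self (i : ℕ) : levelMap one lam i i le_rfl = LinearMap.id := Nat.leRecOn_self _

lemma levelMap_succ (i j : ℕ) (hij : i ≤ j) :
    levelMap one lam i (j + 1) (Nat.le_succ_of_le hij) =
      levelStep one lam j ∘ₗ levelMap one lam i j hij := Nat.leRecOn_succ hij _

lemma levelMap_equivariant (g : UAut one) (i j : ℕ) (hij : i ≤ j) :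
    schurRep one _ g ∘ₗ levelMap one lam i j hij = levelMap one lam i j hij ∘ₗ schurRep one _ g := by
  induction j, hij using Nat.le_induction with
  | base => rw [levelMap_self]; rfl
  | succ j hij ih =>
    have hs : schurRep one _ g ∘ₗ levelStep one lam j = levelStep one lam j ∘ₗ schurRep one _ g :=
      LinearMap.ext fun y => schurMap_stab _ one (autLin g) (autLin_one g) y
    rw [levelMap_succ one lam i j hij, ← LinearMap.comp_assoc, hs, LinearMap.comp_assoc, ih,
      LinearMap.comp_assoc]

/-- The direct limit `𝕊^{λ,∞} V` of the spaces `𝕊^{λ̃(n)} V` along the maps `φ_{λ,n}`. -/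
abbrev SchurInf : Type _ := Module.DirectLimit (level V lam) (levelMap one lam)

/-- The canonical map `𝕊^{λ̃(n)} V → 𝕊^{λ,∞} V`, `n = |λ| + λ₁ + k`. -/
def toInf (k : ℕ) : level V lam k →ₗ[ℂ] SchurInf one lam :=
  Module.DirectLimit.of ℂ ℕ (level V lam) (levelMap one lam) k

/-- The representation of `Aut(V, 𝟙)` on `𝕊^{λ,∞} V`. -/
def infRep : Representation ℂ (UAut one) (SchurInf one lam) where
  toFun g := Module.DirectLimit.map (fun _ => schurRep one _ g)
    (fun i j hij => levelMap_equivariant one lam g i j hij)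
  map_one' := by
    apply Module.DirectLimit.hom_ext
    intro i
    ext x
    simp
  map_mul' g g' := by
    apply Module.DirectLimit.hom_ext
    intro i
    ext x
    simp

/-! ### The induced representation `E_λ` -/

variable {one}
variable (hone : one ≠ 0) {U : Submodule ℂ V} (hU : IsCompl (ℂ ∙ one) U)

/-- The component `V → U` of the splitting `V = ℂ𝟙 ⊕ U`. -/
def toU : V →ₗ[ℂ] U := U.projectionOnto (ℂ ∙ one) hU.symm

/-- The coordinate `V → ℂ` along `𝟙` in the splitting `V = ℂ𝟙 ⊕ U`. -/
def coord : V →ₗ[ℂ] ℂ :=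
  (LinearEquiv.toSpanNonzeroSingleton ℂ V one hone).symm.toLinearMap ∘ₗ
    (ℂ ∙ one).projectionOnto U hU

lemma toU_one : toU hU one = 0 := by
  simp [toU, Submodule.mem_span_singleton_self]

lemma toU_coe (u : U) : toU hU u = u := by simp [toU]

lemma coord_one : coord hone hU one = 1 := by
  have : (ℂ ∙ one).projectionOnto U hU one = ⟨one, Submodule.mem_span_singleton_self one⟩ :=
    Submodule.projectionOnto_apply_of_mem_left hU _
  rw [coord, LinearMap.comp_apply, this]
  exact LinearEquiv.coord_self ℂ V one hone

lemma coord_coe (u : U) : coord hone hU u = 0 := by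
  simp [coord]

lemma coord_add_toU (v : V) : coord hone hU v • one + (toU hU v : V) = v := by
  obtain ⟨a, b, ha, hb, rfl⟩ : ∃ a b, a ∈ ℂ ∙ one ∧ b ∈ U ∧ a + b = v := by
    have : v ∈ (ℂ ∙ one) ⊔ U := by rw [hU.sup_eq_top]; trivial
    obtain ⟨a, ha, b, hb, e⟩ := Submodule.mem_sup.1 this
    exact ⟨a, b, ha, hb, e⟩
  obtain ⟨r, rfl⟩ := Submodule.mem_span_singleton.1 ha
  have h1 := toU_coe hU ⟨b, hb⟩
  have h2 := coord_coe hone hU ⟨b, hb⟩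
  simp only at h1 h2
  simp [toU_one, coord_one, h1, h2]

/-- The `GL(U)`-component `U → U` of an element `g` of `Aut(V, 𝟙) = GL(U) ⋉ U^*`. -/
def linPart (g : UAut one) : U →ₗ[ℂ] U := toU hU ∘ₗ autLin g ∘ₗ U.subtype

lemma linPart_toU (g : UAut one) (v : V) : linPart hU g (toU hU v) = toU hU (autLin g v) := by
  by_cases hone : one = 0
  · subst hone
    have hv : (toU hU v : V) = v := by
      have : v ∈ U := by
        have h := hU.sup_eq_top
        simp only [Submodule.span_zero_singleton, bot_sup_eq] at h
        rw [h]; trivial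
      exact congrArg Subtype.val (toU_coe hU ⟨v, this⟩)
    simp [linPart, hv]
  · conv_rhs => rw [← coord_add_toU hone hU v]
    simp [linPart, autLin_one, toU_one]

/-- The linear map `V → SU`, `a𝟙 + u ↦ a + u`. -/
def toSym : V →ₗ[ℂ] SymmetricAlgebra ℂ U :=
  Algebra.linearMap ℂ (SymmetricAlgebra ℂ U) ∘ₗ coord hone hU + SymmetricAlgebra.ι ℂ U ∘ₗ toU hU

/-- The action of `g ∈ Aut(V, 𝟙)` on `SU`: the algebra endomorphism that sends a generator `u ∈ U`
to `ξ(u) + A u`, where `g u = ξ(u) 𝟙 + A u`. For `g ∈ GL(U)` (that is, `ξ = 0`) this is the obvious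
action; for `g = ξ ∈ U^*` (that is, `A = 1`) it is the translation `u ↦ u + ξ(u)`, that is `exp(∂_ξ)`
for the derivation `∂_ξ` of `SU` with `∂_ξ u = ξ(u)`. -/
def symAct (g : UAut one) : SymmetricAlgebra ℂ U →ₐ[ℂ] SymmetricAlgebra ℂ U :=
  SymmetricAlgebra.lift (toSym hone hU ∘ₗ autLin g ∘ₗ U.subtype)

lemma symAct_toSym (g : UAut one) (v : V) :
    symAct hone hU g (toSym hone hU v) = toSym hone hU (autLin g v) := by
  conv_rhs => rw [← coord_add_toU hone hU v]
  simp [toSym, symAct, autLin_one, toU_one, coord_one, SymmetricAlgebra.lift_ι_apply,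
    Algebra.algebraMap_eq_smul_one, add_smul, add_assoc]

lemma toSym_coe (u : U) : toSym hone hU u = SymmetricAlgebra.ι ℂ U u := by
  simp [toSym, coord_coe, toU_coe]

/-- The representation of `Aut(V, 𝟙)` on `SU`. -/
def symRep : Representation ℂ (UAut one) (SymmetricAlgebra ℂ U) where
  toFun g := (symAct hone hU g).toLinearMap
  map_one' := by
    have : symAct hone hU (1 : UAut one) = AlgHom.id ℂ _ := by
      apply SymmetricAlgebra.algHom_ext
      ext u
      simp [symAct, autLin_id, toSym_coe]
    rw [this]; rfl
  map_mul' g g' := by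
    have : symAct hone hU (g * g') = (symAct hone hU g).comp (symAct hone hU g') := by
      apply SymmetricAlgebra.algHom_ext
      ext u
      have : ∀ g : UAut one, symAct hone hU g (SymmetricAlgebra.ι ℂ U u) =
          toSym hone hU (autLin g u) := fun g => by
        rw [← toSym_coe hone hU, symAct_toSym]
      simp [this, symAct_toSym, autLin_mul]
    rw [this]; rfl

/-- The representation of `Aut(V, 𝟙)` on `𝕊^λ U`, through `Aut(V, 𝟙) → GL(U)`. -/
def schurURep : Representation ℂ (UAut one) (schur lam U) where
  toFun g := schurMap lam (linPart hU g)
  map_one' := by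
    have : linPart hU (1 : UAut one) = LinearMap.id := by
      ext u
      simp [linPart, autLin_id, toU_coe]
    rw [this, schurMap_id]; rfl
  map_mul' g g' := by
    have : linPart hU (g * g') = linPart hU g ∘ₗ linPart hU g' := by
      ext u
      have h1 : linPart hU g (linPart hU g' u) = linPart hU (g * g') u :=
        linPart_toU hU g (autLin g' u)
      rw [LinearMap.comp_apply, h1]
    rw [this, schurMap_comp]; rfl

/-- The underlying space `SU ⊗ 𝕊^λ U` of `E_λ`. -/
abbrev ESpace (U : Submodule ℂ V) : Type _ := SymmetricAlgebra ℂ U ⊗[ℂ] schur lam U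

/-- The induced representation `E_λ = Ind_{GL(U)}^{GL(U) ⋉ U^*} 𝕊^λ U = SU ⊗ 𝕊^λ U` (where `SU` is the
space of polynomial functions on `U^*`): `GL(U)` acts in the obvious way, and `U^*` acts by
(exponentiated) differentiation in the first factor. -/
def ERep : Representation ℂ (UAut one) (ESpace lam U) :=
  (symRep hone hU).tprod (schurURep lam hU)

/-! ### Normalization -/

variable (one) {lam} in
/-- The family of vectors that puts `𝟙` into all cells of row `0` of `λ̃(n)`, and the vectors `w` into
the other cells, which form a copy of `λ`. -/
def withOnes {n : ℕ} (h : lam.card + lam.rowLen 0 ≤ n) (w : lam.cells → U) :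
    (tilde lam n h).cells → V
  | ⟨(0, _), _⟩ => one
  | ⟨(i + 1, j), hc⟩ => w ⟨(i, j), succ_mem_tilde.1 hc⟩

variable (one) {lam}

/-- A linear map `f : 𝕊^{λ̃(n)} V → E_λ` is normalized if it restricts to the identity on the canonical
copy of `𝕊^λ U`, that is, if it sends `c_{λ̃(n)} (𝟙^{⊗ (n - |λ|)} ⊗ w)` to `1 ⊗ c_λ w`. -/
def IsNormalized {n : ℕ} (h : lam.card + lam.rowLen 0 ≤ n)
    (f : schur (tilde lam n h) V →ₗ[ℂ] ESpace lam U) : Prop :=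
  ∀ w : lam.cells → U,
    f (schurMk _ (PiTensorProduct.tprod ℂ (withOnes one h w))) =
      (1 : SymmetricAlgebra ℂ U) ⊗ₜ[ℂ] schurMk lam (PiTensorProduct.tprod ℂ w)

end Aut

end UnitalSchur

end

open scoped TensorProduct
open UnitalSchur

/-!
The proof uses no representation theory of `GL(U)`. Elements of `𝕊^μ W` are detected by functionals:
for functionals `ξ 0, ξ 1, …` on `W`, let `rowPair μ ξ` be the product functional on `W^{⊗ |μ|}` that uses
`ξ i` in all cells of row `i`. Polarization shows that an element of `𝕊^μ W`, being symmetric along the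
rows, vanishes if all these functionals vanish on it (`eq_zero_of_forall_rowPair`).

*Construction.* Multiplying the vectors in the first row of `λ̃(n)` in `SU` (under `a𝟙 + u ↦ a + u`) and
projecting all other vectors to `U` gives an equivariant map `V^{⊗ n} → SU ⊗ U^{⊗ |λ|}` (`splitMap`). On
`𝕊^{λ̃(n)} V` it takes values in `SU ⊗ 𝕊^λ U`, because the row and column groups of `λ` are contained in those
of `λ̃(n)`; divided by `(n - |λ|)!` it is the normalized homomorphism `toE`. The projection
`𝕊^{λ̃(n)} V ⊗ V → 𝕊^{λ̃(n+1)} V` becomes multiplication in `SU` (`toE_schurProj`). This gives the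
compatibility with the stabilization maps, and the surjectivity of the limit.

*Injectivity.* By column antisymmetry, `rowPair ξ` does not change on `𝕊^{λ̃(n)} V` if multiples of `ξ 0` are
added to the other `ξ i`. If `ξ 0` does not vanish on `𝟙`, one can therefore assume that the others do;
but then `rowPair ξ` factors through `toE`. The condition on `ξ 0` is generic, hence harmless, and so
`toE` is injective (`toE_injective`). Injectivity of the stabilization maps follows.

*Uniqueness.* A homomorphism to `E_λ` is determined by its composition `φ` with the evaluation
`E_λ → 𝕊^λ U` at `0 ∈ U^*` (`eq_of_evalTens_zero_eq`). Since `φ` commutes with `GL(U)`, it commutes with the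
endomorphisms `∑ s_i ξ_i ⊗ e_i` of `U` (`commute_finite_rank`). A column antisymmetrized tensor of weight
`λ` is a multiple of the highest weight one, as a filling of content `λ` without repetitions in the columns
is a column permutation of the standard one (`exists_colGroup_of_content`). So comparison of the
coefficients of `∏ s_i ^ λ_i` gives
`rowPair ξ̃ (b t) • φ (ṽ) = rowPair ξ (b t') • v`, where `φ (c t) = c t'`, where `v`, `ṽ` are highest weight
vectors, and where `ξ̃` consists of the coordinate along `𝟙` and the `ξ i` (`rowPair_smul_highestWeight`).
Hence `rowPair ξ (φ y)` is, up to a scalar independent of `y` and `ξ`, equal to `rowPair ξ̃ y`, which is the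
corresponding value for `toE`. So `φ` is determined up to a scalar (`exists_eq_smul_toEHom`).
-/

open scoped TensorProduct

noncomputable section

namespace UnitalSchur

open PiTensorProduct Module

/-! ### Comparing coefficients of vector-valued polynomials -/

/-- Two polynomial functions of `s` with coefficients in a vector space that agree for all `s` have the
same coefficient at each monomial. -/
lemma sum_coeff_eq_of_forall_eval {σ I J N : Type*} [Fintype σ] [Fintype I] [Fintype J]
    [AddCommGroup N] [Module ℂ N] (A : I → σ → ℕ) (u : I → N) (B : J → σ → ℕ) (v : J → N)
    (h : ∀ s : σ → ℂ, ∑ x, (∏ i, s i ^ A x i) • u x = ∑ x, (∏ i, s i ^ B x i) • v x)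
    (m : σ → ℕ) : ∑ x with A x = m, u x = ∑ x with B x = m, v x := by
  classical
  rw [← sub_eq_zero, ← Module.forall_dual_apply_eq_zero_iff ℂ]
  intro l
  have key : ∑ x, MvPolynomial.monomial (Finsupp.equivFunOnFinite.symm (A x)) (l (u x)) =
      ∑ x, MvPolynomial.monomial (Finsupp.equivFunOnFinite.symm (B x)) (l (v x)) := by
    apply MvPolynomial.funext
    intro s
    have := congrArg l (h s)
    simpa [MvPolynomial.eval_monomial, Finsupp.prod_fintype, mul_comm] using this
  have := congrArg (MvPolynomial.coeff (Finsupp.equivFunOnFinite.symm m)) key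
  simp only [MvPolynomial.coeff_sum, MvPolynomial.coeff_monomial, EmbeddingLike.apply_eq_iff_eq]
    at this
  rw [map_sub, map_sum, map_sum, Finset.sum_filter, Finset.sum_filter, this, sub_self]

lemma sum_coeff_eq_zero_of_forall_eval {σ I N : Type*} [Fintype σ] [Fintype I]
    [AddCommGroup N] [Module ℂ N] (A : I → σ → ℕ) (u : I → N)
    (h : ∀ s : σ → ℂ, ∑ x, (∏ i, s i ^ A x i) • u x = 0) (m : σ → ℕ) :
    ∑ x with A x = m, u x = 0 := by
  rw [sum_coeff_eq_of_forall_eval A u (fun (x : Empty) _ => x.elim) (fun x => x.elim)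
    (fun s => by rw [h, Finset.sum_of_isEmpty]) m, Finset.sum_of_isEmpty]

/-- A multilinear form restricted to a line is a polynomial in the parameter. -/
lemma exists_polynomial_multilinear_line {ι M : Type*} [Fintype ι] [AddCommGroup M] [Module ℂ M]
    (f : MultilinearMap ℂ (fun _ : ι => M) ℂ) (x y : ι → M) :
    ∃ P : Polynomial ℂ, ∀ r : ℂ, f (fun i => r • x i + y i) = P.eval r := by
  classical
  refine ⟨∑ S : Finset ι, Polynomial.C (f (S.piecewise x y)) * Polynomial.X ^ S.card, fun r => ?_⟩
  have h1 := f.map_add_univ (fun i => r • x i) y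
  rw [show (fun i => r • x i + y i) = (fun i => r • x i) + y from rfl, h1,
    Polynomial.eval_finsetSum]
  refine Finset.sum_congr rfl fun S _ => ?_
  have h2 : S.piecewise (fun i => r • x i) y =
      fun i => (if i ∈ S then r else 1) • S.piecewise x y i := by
    funext i
    by_cases hi : i ∈ S <;> simp [hi]
  rw [h2, f.map_smul_univ, Finset.prod_ite_mem, Finset.univ_inter, Finset.prod_const, smul_eq_mul,
    mul_comm, Polynomial.eval_mul, Polynomial.eval_C, Polynomial.eval_pow, Polynomial.eval_X]

lemma eval_eq_of_forall_mem_infinite (P Q : Polynomial ℂ) {S : Set ℂ} (hS : S.Infinite)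
    (h : ∀ r ∈ S, P.eval r = Q.eval r) (r : ℂ) : P.eval r = Q.eval r := by
  rw [Polynomial.eq_of_infinite_eval_eq P Q (hS.mono h)]

/-! ### Product functionals on tensor powers -/

section Pairing

variable (μ : YoungDiagram) {W : Type*} [AddCommGroup W] [Module ℂ W]

/-- The product functional `x ↦ ∏ c, η c (x c)` on `W^{⊗ |μ|}`. -/
def pair (η : μ.cells → Dual ℂ W) : Dual ℂ (Tens μ W) := dualDistrib (tprod ℂ η)

@[simp] lemma pair_tprod (η : μ.cells → Dual ℂ W) (x : μ.cells → W) :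
    pair μ η (tprod ℂ x) = ∏ c, η c (x c) := dualDistrib_apply _ _

/-- The value of `pair μ η` at a fixed tensor, as a multilinear form in `η`. -/
def pairAt (t : Tens μ W) : MultilinearMap ℂ (fun _ : μ.cells => Dual ℂ W) ℂ :=
  (LinearMap.applyₗ t ∘ₗ dualDistrib).compMultilinearMap (tprod ℂ)

lemma pairAt_apply (t : Tens μ W) (η : μ.cells → Dual ℂ W) : pairAt μ t η = pair μ η t := rfl

lemma pair_permT (η : μ.cells → Dual ℂ W) (σ : Equiv.Perm μ.cells) (t : Tens μ W) :
    pair μ η (permT μ W σ t) = pair μ (η ∘ σ) t := by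
  have : pair μ η ∘ₗ permT μ W σ = pair μ (η ∘ σ) := by
    apply PiTensorProduct.ext
    ext x
    simp only [LinearMap.compMultilinearMap_apply, LinearMap.comp_apply, permT_tprod, pair_tprod]
    exact Fintype.prod_equiv σ.symm _ _ fun c => by simp
  exact LinearMap.congr_fun this t

lemma eq_zero_of_forall_pair {t : Tens μ W} (h : ∀ η, pair μ η t = 0) : t = 0 := by
  let B := Basis.ofVectorSpace ℂ W
  apply (Basis.piTensorProduct fun _ : μ.cells => B).ext_elem
  intro p
  have : (Basis.piTensorProduct fun _ : μ.cells => B).coord p = pair μ fun c => B.coord (p c) := by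
    apply PiTensorProduct.ext
    ext x
    simp
  have h1 := LinearMap.congr_fun this t
  rw [h, Basis.coord_apply] at h1
  simp [h1]

/-! ### Symmetrizers and antisymmetrizers -/

lemma mem_rowGroup {σ : Equiv.Perm μ.cells} : σ ∈ rowGroup μ ↔ ∀ c, (σ c).1.1 = c.1.1 := by
  simp [rowGroup]

lemma mem_colGroup {σ : Equiv.Perm μ.cells} : σ ∈ colGroup μ ↔ ∀ c, (σ c).1.2 = c.1.2 := by
  simp [colGroup]

lemma permT_rowSym {τ : Equiv.Perm μ.cells} (hτ : τ ∈ rowGroup μ) (t : Tens μ W) :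
    permT μ W τ (rowSym μ W t) = rowSym μ W t := by
  simp only [rowSym, LinearMap.sum_apply, map_sum, ← permT_mul]
  rw [mem_rowGroup] at hτ
  refine Finset.sum_bij' (fun σ _ => τ * σ) (fun σ _ => τ⁻¹ * σ) ?_ ?_ ?_ ?_ ?_
  · intro σ hσ
    rw [mem_rowGroup] at hσ ⊢
    intro c
    rw [Equiv.Perm.mul_apply, hτ, hσ]
  · intro σ hσ
    rw [mem_rowGroup] at hσ ⊢
    intro c
    rw [Equiv.Perm.mul_apply, ← hτ, Equiv.Perm.inv_def, Equiv.apply_symm_apply, hσ]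
  all_goals simp

lemma permT_schur {τ : Equiv.Perm μ.cells} (hτ : τ ∈ rowGroup μ) (y : schur μ W) :
    permT μ W τ y = y := by
  obtain ⟨t, rfl⟩ := schurMk_surjective μ y
  exact permT_rowSym μ hτ _

lemma permT_colAnti {τ : Equiv.Perm μ.cells} (hτ : τ ∈ colGroup μ) (t : Tens μ W) :
    permT μ W τ (colAnti μ W t) = ((Equiv.Perm.sign τ : ℤ) : ℂ) • colAnti μ W t := by
  simp only [colAnti, LinearMap.sum_apply, map_sum, LinearMap.smul_apply, map_smul, ← permT_mul,
    Finset.smul_sum, smul_smul]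
  rw [mem_colGroup] at hτ
  refine Finset.sum_bij' (fun σ _ => τ * σ) (fun σ _ => τ⁻¹ * σ) ?_ ?_ ?_ ?_ ?_
  · intro σ hσ
    rw [mem_colGroup] at hσ ⊢
    intro c
    rw [Equiv.Perm.mul_apply, hτ, hσ]
  · intro σ hσ
    rw [mem_colGroup] at hσ ⊢
    intro c
    rw [Equiv.Perm.mul_apply, ← hτ, Equiv.Perm.inv_def, Equiv.apply_symm_apply, hσ]
  · simp
  · simp
  · intro σ _
    congr 1
    rw [Equiv.Perm.sign_mul]
    rcases Int.units_eq_one_or (Equiv.Perm.sign τ) with h | h <;> simp [h]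

lemma colAnti_permT {τ : Equiv.Perm μ.cells} (hτ : τ ∈ colGroup μ) (t : Tens μ W) :
    colAnti μ W (permT μ W τ t) = ((Equiv.Perm.sign τ : ℤ) : ℂ) • colAnti μ W t := by
  simp only [colAnti, LinearMap.sum_apply, LinearMap.smul_apply, ← permT_mul,
    Finset.smul_sum, smul_smul]
  rw [mem_colGroup] at hτ
  refine Finset.sum_bij' (fun σ _ => σ * τ) (fun σ _ => σ * τ⁻¹) ?_ ?_ ?_ ?_ ?_
  · intro σ hσ
    rw [mem_colGroup] at hσ ⊢
    intro c
    rw [Equiv.Perm.mul_apply, hσ, hτ]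
  · intro σ hσ
    rw [mem_colGroup] at hσ ⊢
    intro c
    rw [Equiv.Perm.mul_apply, hσ, ← hτ, Equiv.Perm.inv_def, Equiv.apply_symm_apply]
  · simp
  · simp
  · intro σ _
    congr 1
    rw [Equiv.Perm.sign_mul]
    rcases Int.units_eq_one_or (Equiv.Perm.sign τ) with h | h <;> simp [h]

lemma swap_mem_colGroup {c c' : μ.cells} (hcol : c.1.2 = c'.1.2) :
    Equiv.swap c c' ∈ colGroup μ := by
  rw [mem_colGroup]
  intro d
  rw [Equiv.swap_apply_def]
  split_ifs with h1 h2
  · rw [h1, hcol]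
  · rw [h2, hcol]
  · rfl

lemma colAnti_tprod_eq_zero {x : μ.cells → W} {c c' : μ.cells} (hne : c ≠ c')
    (hcol : c.1.2 = c'.1.2) (hx : x c = x c') : colAnti μ W (tprod ℂ x) = 0 := by
  have h := colAnti_permT μ (swap_mem_colGroup μ hcol) (tprod ℂ x)
  rw [permT_tprod, Equiv.symm_swap, Equiv.Perm.sign_swap hne] at h
  have hx' : (fun d => x (Equiv.swap c c' d)) = x := by
    funext d
    rw [Equiv.swap_apply_def]
    split_ifs with h1 h2
    · rw [h1, hx]
    · rw [h2, hx]
    · rfl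
  rw [hx'] at h
  have h2 : (2 : ℂ) • colAnti μ W (tprod ℂ x) = 0 := by
    rw [two_smul]
    nth_rewrite 1 [h]
    simp
  exact (smul_eq_zero.1 h2).resolve_left two_ne_zero

lemma pair_colAnti_eq_zero {η : μ.cells → Dual ℂ W} {c c' : μ.cells} (hne : c ≠ c')
    (hcol : c.1.2 = c'.1.2) (hη : η c = η c') (t : Tens μ W) : pair μ η (colAnti μ W t) = 0 := by
  have h := congrArg (pair μ η) (permT_colAnti μ (swap_mem_colGroup μ hcol) t)
  rw [pair_permT, Equiv.Perm.sign_swap hne, map_smul] at h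
  have hη' : η ∘ Equiv.swap c c' = η := by
    funext d
    rw [Function.comp_apply, Equiv.swap_apply_def]
    split_ifs with h1 h2
    · rw [h1, hη]
    · rw [h2, hη]
    · rfl
  rw [hη'] at h
  simpa [self_eq_neg] using h

/-- The product functional that uses the functional `ξ i` in all cells of row `i`. -/
abbrev rowPair (ξ : ℕ → Dual ℂ W) : Dual ℂ (Tens μ W) := pair μ fun c => ξ c.1.1

lemma rowPair_rowSym (ξ : ℕ → Dual ℂ W) (t : Tens μ W) :
    rowPair μ ξ (rowSym μ W t) = ((rowGroup μ).card : ℂ) • rowPair μ ξ t := by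
  rw [rowSym, LinearMap.sum_apply, map_sum, Finset.sum_congr rfl fun σ hσ => ?_, Finset.sum_const,
    Nat.cast_smul_eq_nsmul]
  rw [pair_permT]
  congr 2
  funext c
  simp only [Function.comp_apply, (mem_rowGroup μ).1 hσ c]

lemma rowPair_schurMk (ξ : ℕ → Dual ℂ W) (t : Tens μ W) :
    rowPair μ ξ (schurMk μ t : Tens μ W) =
      ((rowGroup μ).card : ℂ) • rowPair μ ξ (colAnti μ W t) := rowPair_rowSym μ ξ _

/-- Polarization: a tensor that is symmetric along the rows is determined by the values of the
product functionals that are constant along the rows. -/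
lemma eq_zero_of_forall_rowPair {y : Tens μ W} (hy : ∀ σ ∈ rowGroup μ, permT μ W σ y = y)
    (h : ∀ ξ, rowPair μ ξ y = 0) : y = 0 := by
  classical
  apply eq_zero_of_forall_pair
  intro η
  let v : (μ.cells → μ.cells) → ℂ := fun φ =>
    pair μ (fun c => if (φ c).1.1 = c.1.1 then η (φ c) else 0) y
  have key : ∀ s : μ.cells → ℂ,
      ∑ φ : μ.cells → μ.cells, (∏ d, s d ^ (Finset.univ.filter fun c => φ c = d).card) • v φ = 0 := by
    intro s
    have h1 := h fun i => ∑ d : μ.cells, if d.1.1 = i then s d • η d else 0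
    rw [rowPair, ← pairAt_apply, MultilinearMap.map_sum] at h1
    rw [← h1]
    refine Finset.sum_congr rfl fun φ _ => ?_
    have h2 : (fun c : μ.cells => if (φ c).1.1 = c.1.1 then s (φ c) • η (φ c) else 0) =
        fun c => s (φ c) • if (φ c).1.1 = c.1.1 then η (φ c) else 0 := by
      funext c
      split_ifs <;> simp
    rw [h2, MultilinearMap.map_smul_univ, pairAt_apply]
    congr 1
    rw [← Finset.prod_fiberwise' Finset.univ φ s]
    exact Finset.prod_congr rfl fun d _ => by rw [Finset.prod_const]
  have h3 := sum_coeff_eq_zero_of_forall_eval _ v key fun _ => 1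
  have h4 : ∑ φ with (fun d => (Finset.univ.filter fun c => φ c = d).card) = (fun _ => 1), v φ =
      ∑ σ ∈ rowGroup μ, pair μ η y := by
    symm
    refine Finset.sum_of_injOn (fun σ : Equiv.Perm μ.cells => (σ : μ.cells → μ.cells)) ?_ ?_ ?_ ?_
    · intro σ _ τ _ he
      exact Equiv.coe_fn_injective he
    · intro σ _
      simp only [Finset.coe_filter, Finset.mem_univ, true_and, Set.mem_ofPred_eq]
      funext d
      rw [Finset.card_eq_one]
      exact ⟨σ.symm d, by ext c; simp [Equiv.eq_symm_apply]⟩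
    · intro φ hφ hn
      simp only [Finset.mem_filter, Finset.mem_univ, true_and] at hφ
      have hsurj : Function.Surjective φ := by
        intro d
        have := congrFun hφ d
        obtain ⟨c, hc⟩ := Finset.card_pos.1 (by rw [this]; exact one_pos)
        exact ⟨c, by simpa using hc⟩
      have hbij : Function.Bijective φ := Finite.injective_iff_bijective.1
        (Finite.injective_iff_surjective.2 hsurj)
      by_contra hv
      apply hn
      refine ⟨Equiv.ofBijective φ hbij, ?_, rfl⟩
      rw [Finset.mem_coe, mem_rowGroup]
      intro c
      by_contra hc
      apply hv
      change pairAt μ y _ = 0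
      exact MultilinearMap.map_coord_zero _ c (if_neg hc)
    · intro σ hσ
      conv_lhs => rw [← hy σ hσ, pair_permT]
      simp only [v, (mem_rowGroup μ).1 hσ, if_true]
      rfl
  rw [h3, Finset.sum_const, ← Nat.cast_smul_eq_nsmul ℂ, smul_eq_mul] at h4
  exact (mul_eq_zero.1 h4.symm).resolve_left (rowGroup_card_ne_zero μ)

lemma schur_eq_zero_of_forall_rowPair {y : schur μ W} (h : ∀ ξ, rowPair μ ξ (y : Tens μ W) = 0) :
    y = 0 :=
  Subtype.ext (eq_zero_of_forall_rowPair μ (fun _ hσ => permT_schur μ hσ y) h)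

/-- On the image of the column antisymmetrizer, the functional `rowPair μ ξ` does not change when
multiples of `ξ 0` are added to the functionals `ξ i`, `i > 0`. -/
lemma rowPair_colAnti_shear (ξ : ℕ → Dual ℂ W) (a : ℕ → ℂ) (ha : a 0 = 0) (t : Tens μ W) :
    rowPair μ (fun i => a i • ξ 0 + ξ i) (colAnti μ W t) = rowPair μ ξ (colAnti μ W t) := by
  classical
  have h := (pairAt μ (colAnti μ W t)).map_add_univ (fun c => a c.1.1 • ξ 0) (fun c => ξ c.1.1)
  rw [rowPair, ← pairAt_apply]
  refine h.trans ?_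
  rw [Finset.sum_eq_single ∅]
  · simp [pairAt_apply]
  · intro S _ hS
    obtain ⟨c, hc⟩ := Finset.nonempty_iff_ne_empty.2 hS
    have h2 : S.piecewise (fun c => a c.1.1 • ξ 0) (fun c => ξ c.1.1) =
        fun d => (if d ∈ S then a d.1.1 else 1) • if d ∈ S then ξ 0 else ξ d.1.1 := by
      funext d
      by_cases hd : d ∈ S <;> simp [hd]
    rw [h2, MultilinearMap.map_smul_univ, pairAt_apply]
    by_cases h0 : c.1.1 = 0
    · rw [Finset.prod_eq_zero (Finset.mem_univ c), zero_smul]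
      simp [hc, h0, ha]
    · have hmem : (0, c.1.2) ∈ μ.cells := by
        have hc' : (c.1.1, c.1.2) ∈ μ := c.2
        exact μ.up_left_mem (Nat.zero_le _) le_rfl hc'
      rw [pair_colAnti_eq_zero μ (c := c) (c' := ⟨(0, c.1.2), hmem⟩), smul_zero]
      · intro he
        exact h0 (congrArg (fun d : μ.cells => d.1.1) he)
      · rfl
      · simp [hc]
  · simp

end Pairing

/-! ### Fillings of a diagram and weight components of the Schur functor -/

section Fillings

variable (μ : YoungDiagram)

/-- In each column, a filling with distinct entries has at most as many entries below a given bound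
as the filling by row indices. -/
lemma card_col_filter_lt_le {x : μ.cells → ℕ}
    (hcol : ∀ c c' : μ.cells, c.1.2 = c'.1.2 → x c = x c' → c = c') (r j : ℕ) :
    (Finset.univ.filter fun c : μ.cells => c.1.2 = j ∧ x c < r).card ≤
      (Finset.univ.filter fun c : μ.cells => c.1.2 = j ∧ c.1.1 < r).card := by
  rcases le_or_gt r (μ.colLen j) with hr | hr
  · calc _ ≤ (Finset.range r).card := by
          refine Finset.card_le_card_of_injOn x (fun c hc => ?_) fun c hc c' hc' he => ?_
          · simpa using (Finset.mem_filter.1 hc).2.2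
          · exact hcol c c' (((Finset.mem_filter.1 hc).2.1).trans
              (Finset.mem_filter.1 hc').2.1.symm) he
      _ ≤ _ := by
          have hmem : ∀ i ∈ Finset.range r, (i, j) ∈ μ.cells := fun i hi => by
            rw [YoungDiagram.mem_cells, YoungDiagram.mem_iff_lt_colLen]
            exact (Finset.mem_range.1 hi).trans_le hr
          rw [← Finset.card_attach]
          refine Finset.card_le_card_of_injOn (fun i => ⟨(i.1, j), hmem _ i.2⟩) (fun i _ => ?_)
            fun i _ i' _ he => ?_
          · exact Finset.mem_filter.2 ⟨Finset.mem_univ _, rfl, Finset.mem_range.1 i.2⟩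
          · exact Subtype.ext (congrArg (fun c : μ.cells => c.1.1) he)
  · refine Finset.card_le_card fun c hc => ?_
    simp only [Finset.mem_filter, Finset.mem_univ, true_and] at hc ⊢
    refine ⟨hc.1, lt_of_lt_of_le ?_ hr.le⟩
    have hc' : (c.1.1, c.1.2) ∈ μ := c.2
    rwa [YoungDiagram.mem_iff_lt_colLen, hc.1] at hc'

/-- A filling of `μ` of content `μ` whose columns have distinct entries is the filling by row indices
up to a permutation in the column group. -/
lemma exists_colGroup_of_content {x : μ.cells → ℕ}
    (hcol : ∀ c c' : μ.cells, c.1.2 = c'.1.2 → x c = x c' → c = c')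
    (hcont : ∀ i, (Finset.univ.filter fun c => x c = i).card =
      (Finset.univ.filter fun c : μ.cells => c.1.1 = i).card) :
    ∃ τ ∈ colGroup μ, ∀ c, x c = (τ c).1.1 := by
  classical
  have hlt : ∀ r, (Finset.univ.filter fun c => x c < r).card =
      (Finset.univ.filter fun c : μ.cells => c.1.1 < r).card := by
    intro r
    rw [Finset.card_eq_sum_card_fiberwise (f := x) (t := Finset.range r) (by intro c; simp),
      Finset.card_eq_sum_card_fiberwise (f := fun c : μ.cells => c.1.1) (t := Finset.range r)
        (by intro c; simp)]
    refine Finset.sum_congr rfl fun i hi => ?_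
    rw [Finset.mem_range] at hi
    convert hcont i using 2 <;>
    · ext c
      simp only [Finset.mem_filter, Finset.mem_univ, true_and]
      constructor
      · exact fun h => h.2
      · exact fun h => ⟨h ▸ hi, h⟩
  have hall : ∀ c, x c < μ.colLen c.1.2 := by
    intro c₀
    set r := μ.colLen c₀.1.2 with hr
    let J := Finset.univ.image fun c : μ.cells => c.1.2
    have hsum : ∑ j ∈ J, (Finset.univ.filter fun c : μ.cells => c.1.2 = j ∧ x c < r).card =
        ∑ j ∈ J, (Finset.univ.filter fun c : μ.cells => c.1.2 = j ∧ c.1.1 < r).card := by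
      have h1 := hlt r
      rw [Finset.card_eq_sum_card_fiberwise (f := fun c : μ.cells => c.1.2) (t := J)
          (by intro c _; simp [J]),
        Finset.card_eq_sum_card_fiberwise (f := fun c : μ.cells => c.1.2) (t := J)
          (by intro c _; simp [J])] at h1
      simpa only [Finset.filter_filter, and_comm] using h1
    rw [Finset.sum_eq_sum_iff_of_le fun j _ => card_col_filter_lt_le μ hcol r j] at hsum
    have h2 := hsum c₀.1.2 (Finset.mem_image_of_mem _ (Finset.mem_univ c₀))
    have h3 : (Finset.univ.filter fun c : μ.cells => c.1.2 = c₀.1.2 ∧ c.1.1 < r) =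
        Finset.univ.filter fun c : μ.cells => c.1.2 = c₀.1.2 := by
      refine Finset.filter_congr fun c _ => ⟨fun h => h.1, fun h => ⟨h, ?_⟩⟩
      have hc' : (c.1.1, c.1.2) ∈ μ := c.2
      rwa [YoungDiagram.mem_iff_lt_colLen, h] at hc'
    rw [h3, ← Finset.filter_filter, Finset.card_filter_eq_iff] at h2
    exact h2 c₀ (by simp)
  let τ₀ : μ.cells → μ.cells := fun c => ⟨(x c, c.1.2), by
    rw [YoungDiagram.mem_cells, YoungDiagram.mem_iff_lt_colLen]
    exact hall c⟩
  have hinj : Function.Injective τ₀ := by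
    intro c c' he
    have he' : x c = x c' ∧ c.1.2 = c'.1.2 := by simpa [τ₀] using he
    exact hcol c c' he'.2 he'.1
  exact ⟨Equiv.ofBijective τ₀ (Finite.injective_iff_bijective.1 hinj),
    (mem_colGroup μ).2 fun c => rfl, fun c => rfl⟩

variable {W : Type*} [AddCommGroup W] [Module ℂ W]

/-- The tensor power of the map `∑ i, s i • ξ i ⊗ e i`, expanded as a polynomial in `s`. -/
lemma tensMap_sum_smulRight {k : ℕ} (s : Fin k → ℂ) (ξ : ℕ → Dual ℂ W) (e : ℕ → W)
    (t : Tens μ W) :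
    tensMap μ (∑ i : Fin k, s i • (ξ i).smulRight (e i)) t =
      ∑ x : μ.cells → Fin k, (∏ i, s i ^ (Finset.univ.filter fun c => x c = i).card) •
        (pair μ (fun c => ξ (x c)) t • tprod ℂ fun c => e (x c)) := by
  classical
  have : tensMap μ (∑ i : Fin k, s i • (ξ i).smulRight (e i)) =
      ∑ x : μ.cells → Fin k, (∏ i, s i ^ (Finset.univ.filter fun c => x c = i).card) •
        (pair μ fun c => ξ (x c)).smulRight (tprod ℂ fun c => e (x c)) := by
    apply PiTensorProduct.ext
    ext y
    simp only [LinearMap.compMultilinearMap_apply, tensMap_tprod, LinearMap.sum_apply,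
      LinearMap.smul_apply, LinearMap.smulRight_apply, pair_tprod]
    rw [MultilinearMap.map_sum]
    refine Finset.sum_congr rfl fun x _ => ?_
    rw [MultilinearMap.map_smul_univ, MultilinearMap.map_smul_univ]
    congr 1
    rw [← Finset.prod_fiberwise' Finset.univ x s]
    exact Finset.prod_congr rfl fun d _ => by rw [Finset.prod_const]
  rw [this]
  simp [LinearMap.sum_apply]

lemma schurMk_eq_zero_of_colAnti {t : Tens μ W} (h : colAnti μ W t = 0) : schurMk μ t = 0 := by
  apply Subtype.ext
  rw [schurMk_coe, youngSym, LinearMap.comp_apply, h, map_zero]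
  rfl

lemma schurMk_permT {τ : Equiv.Perm μ.cells} (hτ : τ ∈ colGroup μ) (t : Tens μ W) :
    schurMk μ (permT μ W τ t) = ((Equiv.Perm.sign τ : ℤ) : ℂ) • schurMk μ t := by
  apply Subtype.ext
  rw [Submodule.coe_smul, schurMk_coe, schurMk_coe, youngSym, LinearMap.comp_apply,
    LinearMap.comp_apply, colAnti_permT μ hτ, map_smul]

/-- The component of weight `μ` of `c_μ t` is a multiple of the highest weight vector
`c_μ (e 0 ⊗ ⋯ ⊗ e 0 ⊗ e 1 ⊗ ⋯)`, and the factor is the value of a product functional. -/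
lemma sum_content_schurMk {k : ℕ} (hk : ∀ c : μ.cells, c.1.1 < k) (ξ : ℕ → Dual ℂ W) (e : ℕ → W)
    (t : Tens μ W) :
    ∑ x : μ.cells → Fin k with (∀ i : Fin k, (Finset.univ.filter fun c => x c = i).card =
        (Finset.univ.filter fun c : μ.cells => c.1.1 = i).card),
      pair μ (fun c => ξ (x c)) t • schurMk μ (tprod ℂ fun c => e (x c)) =
    rowPair μ ξ (colAnti μ W t) • schurMk μ (tprod ℂ fun c => e c.1.1) := by
  classical
  rw [colAnti, LinearMap.sum_apply, map_sum, Finset.sum_smul]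
  symm
  refine Finset.sum_of_injOn (fun τ c => ⟨(τ c).1.1, hk _⟩) ?_ ?_ ?_ ?_
  · intro τ hτ τ' hτ' he
    ext1 c
    apply Subtype.ext
    refine Prod.ext ?_ ?_
    · simpa using congrArg Fin.val (congrFun he c)
    · rw [(mem_colGroup μ).1 hτ, (mem_colGroup μ).1 hτ']
  · intro τ _
    simp only [Finset.coe_filter, Finset.mem_univ, true_and, Set.mem_ofPred_eq]
    intro i
    refine Finset.card_bij (fun c _ => τ c) (fun c hc => ?_) (fun c _ c' _ he => τ.injective he)
      fun c hc => ⟨τ.symm c, ?_, by simp⟩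
    · simpa [Fin.ext_iff] using hc
    · simpa [Fin.ext_iff] using hc
  · intro x hx hn
    simp only [Finset.mem_filter, Finset.mem_univ, true_and] at hx
    by_cases hcol : ∀ c c' : μ.cells, c.1.2 = c'.1.2 → (x c : ℕ) = x c' → c = c'
    · exfalso
      apply hn
      obtain ⟨τ, hτ, h⟩ := exists_colGroup_of_content μ hcol fun i => by
        rcases lt_or_ge i k with hi | hi
        · simpa [Fin.ext_iff] using hx ⟨i, hi⟩
        · rw [Finset.filter_false_of_mem fun c _ => ((x c).2.trans_le hi).ne,
            Finset.filter_false_of_mem fun c _ => ((hk c).trans_le hi).ne]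
      exact ⟨τ, hτ, by funext c; exact Fin.ext (h c).symm⟩
    · push Not at hcol
      obtain ⟨c, c', h1, h2, h3⟩ := hcol
      rw [schurMk_eq_zero_of_colAnti μ, smul_zero]
      exact colAnti_tprod_eq_zero μ h3 h1 (by rw [h2])
  · intro τ hτ
    have h1 : (tprod ℂ fun c : μ.cells => e c.1.1) =
        permT μ W τ (tprod ℂ fun c => e (τ c).1.1) := by
      rw [permT_tprod]
      simp
    rw [h1, schurMk_permT μ hτ, LinearMap.smul_apply, map_smul, pair_permT, smul_eq_mul, smul_smul]
    congr 1
    rw [mul_right_comm]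
    rcases Int.units_eq_one_or (Equiv.Perm.sign τ) with h | h <;> simp [h, Function.comp_def]

end Fillings

/-! ### The first row of `λ̃(n)` and the copy of `λ` below it -/

section Split

variable {lam : YoungDiagram} {n : ℕ} (h : lam.card + lam.rowLen 0 ≤ n)

/-- The cells of `λ̃(n)` are the cells of `λ`, moved down by one row, and the `n - |λ|` cells of the
first row. -/
def splitCells : lam.cells ⊕ Fin (n - lam.card) ≃ (tilde lam n h).cells :=
  Equiv.ofBijective
    (Sum.elim (fun c => ⟨(c.1.1 + 1, c.1.2), succ_mem_tilde.2 c.2⟩)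
      fun j => ⟨(0, j), zero_mem_tilde.2 j.2⟩) <| by
    constructor
    · rintro (⟨⟨i, j⟩, hc⟩ | j) (⟨⟨i', j'⟩, hc'⟩ | j') he
      · simpa using he
      · simp at he
      · simp at he
      · simpa [Fin.ext_iff] using he
    · rintro ⟨⟨_ | i, j⟩, hc⟩
      · exact ⟨Sum.inr ⟨j, zero_mem_tilde.1 hc⟩, rfl⟩
      · exact ⟨Sum.inl ⟨(i, j), succ_mem_tilde.1 hc⟩, rfl⟩

@[simp] lemma splitCells_inl (c : lam.cells) :
    (splitCells h (Sum.inl c)).1 = (c.1.1 + 1, c.1.2) := rfl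

@[simp] lemma splitCells_inr (j : Fin (n - lam.card)) :
    (splitCells h (Sum.inr j)).1 = (0, (j : ℕ)) := rfl

/-- The permutation of the cells of `λ̃(n)` given by a permutation of the cells of `λ` and a permutation
of the first row. -/
def splitPerm (α : Equiv.Perm lam.cells) (β : Equiv.Perm (Fin (n - lam.card))) :
    Equiv.Perm (tilde lam n h).cells :=
  (splitCells h).permCongr (Equiv.Perm.sumCongr α β)

variable (α : Equiv.Perm lam.cells) (β : Equiv.Perm (Fin (n - lam.card)))

lemma splitPerm_inl (c : lam.cells) :
    splitPerm h α β (splitCells h (Sum.inl c)) = splitCells h (Sum.inl (α c)) := by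
  simp [splitPerm, Equiv.permCongr_apply]

lemma splitPerm_inr (j : Fin (n - lam.card)) :
    splitPerm h α β (splitCells h (Sum.inr j)) = splitCells h (Sum.inr (β j)) := by
  simp [splitPerm, Equiv.permCongr_apply]

lemma splitPerm_symm_inl (c : lam.cells) :
    (splitPerm h α β).symm (splitCells h (Sum.inl c)) = splitCells h (Sum.inl (α.symm c)) := by
  rw [Equiv.symm_apply_eq, splitPerm_inl, Equiv.apply_symm_apply]

lemma splitPerm_symm_inr (j : Fin (n - lam.card)) :
    (splitPerm h α β).symm (splitCells h (Sum.inr j)) = splitCells h (Sum.inr (β.symm j)) := by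
  rw [Equiv.symm_apply_eq, splitPerm_inr, Equiv.apply_symm_apply]

lemma sign_splitPerm :
    Equiv.Perm.sign (splitPerm h α β) = Equiv.Perm.sign α * Equiv.Perm.sign β := by
  simp [splitPerm, Equiv.Perm.sign_permCongr, Equiv.Perm.sign_sumCongr]

lemma splitPerm_injective : Function.Injective fun p : Equiv.Perm lam.cells ×
    Equiv.Perm (Fin (n - lam.card)) => splitPerm h p.1 p.2 := fun _ _ he =>
  Equiv.Perm.sumCongrHom_injective ((splitCells h).permCongr.injective he)

lemma exists_splitPerm {σ : Equiv.Perm (tilde lam n h).cells}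
    (hσ : ∀ c : lam.cells, (σ (splitCells h (Sum.inl c))).1.1 ≠ 0) :
    ∃ α β, splitPerm h α β = σ := by
  have hr : (splitCells h).symm.permCongr σ ∈
      (Equiv.Perm.sumCongrHom lam.cells (Fin (n - lam.card))).range := by
    apply Equiv.Perm.mem_sumCongrHom_range_of_perm_mapsTo_inl
    rintro _ ⟨c, rfl⟩
    rcases hd : (splitCells h).symm.permCongr σ (Sum.inl c) with d | d
    · exact ⟨d, rfl⟩
    · exfalso
      rw [Equiv.permCongr_apply, Equiv.symm_symm, Equiv.symm_apply_eq] at hd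
      exact hσ c (by rw [hd, splitCells_inr])
  obtain ⟨⟨α, β⟩, hσ⟩ := hr
  refine ⟨α, β, ?_⟩
  have h1 : Equiv.Perm.sumCongr α β = (splitCells h).symm.permCongr σ := hσ
  rw [splitPerm, h1]
  exact (splitCells h).permCongr.apply_symm_apply σ

lemma splitPerm_mem_rowGroup : splitPerm h α β ∈ rowGroup _ ↔ α ∈ rowGroup lam := by
  rw [mem_rowGroup, mem_rowGroup]
  constructor
  · intro hs c
    simpa [splitPerm_inl] using hs (splitCells h (Sum.inl c))
  · intro hα c
    obtain ⟨c | j, rfl⟩ := (splitCells h).surjective c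
    · simp [splitPerm_inl, hα c]
    · simp [splitPerm_inr]

lemma splitPerm_mem_colGroup :
    splitPerm h α β ∈ colGroup _ ↔ α ∈ colGroup lam ∧ β = 1 := by
  rw [mem_colGroup, mem_colGroup]
  constructor
  · intro hs
    refine ⟨fun c => ?_, ?_⟩
    · simpa [splitPerm_inl] using hs (splitCells h (Sum.inl c))
    · ext j
      simpa [splitPerm_inr] using hs (splitCells h (Sum.inr j))
  · rintro ⟨hα, rfl⟩ c
    obtain ⟨c | j, rfl⟩ := (splitCells h).surjective c
    · simp [splitPerm_inl, hα c]
    · simp [splitPerm_inr]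

end Split

/-! ### The projection `V^{⊗ n} → SU ⊗ U^{⊗ |λ|}` -/

section SplitMap

variable {V : Type*} [AddCommGroup V] [Module ℂ V] {one : V} (hone : one ≠ 0)
variable {U : Submodule ℂ V} (hU : IsCompl (ℂ ∙ one) U)
variable {lam : YoungDiagram} {n : ℕ} (h : lam.card + lam.rowLen 0 ≤ n)

/-- The map `V^{⊗ n} → SU ⊗ U^{⊗ |λ|}` that multiplies the images in `SU` of the vectors in the first row
of `λ̃(n)` under `a𝟙 + u ↦ a + u`, and projects all the other vectors to `U`. -/
def splitMap : Tens (tilde lam n h) V →ₗ[ℂ] SymmetricAlgebra ℂ U ⊗[ℂ] Tens lam U :=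
  (TensorProduct.comm ℂ _ _).toLinearMap ∘ₗ
    TensorProduct.map (tensMap lam (toU hU))
      (PiTensorProduct.lift ((MultilinearMap.mkPiAlgebra ℂ (Fin (n - lam.card))
        (SymmetricAlgebra ℂ U)).compLinearMap fun _ => toSym hone hU)) ∘ₗ
    (tmulEquiv ℂ V).symm.toLinearMap ∘ₗ
    (reindex ℂ (fun _ => V) (splitCells h).symm).toLinearMap

lemma splitMap_tprod (x : (tilde lam n h).cells → V) :
    splitMap hone hU h (tprod ℂ x) =
      (∏ j, toSym hone hU (x (splitCells h (Sum.inr j)))) ⊗ₜ[ℂ]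
        tprod ℂ fun c => toU hU (x (splitCells h (Sum.inl c))) := by
  simp only [splitMap, LinearMap.comp_apply, LinearEquiv.coe_coe, reindex_tprod,
    tmulEquiv_symm_apply, TensorProduct.map_tmul, TensorProduct.comm_tmul, tensMap_tprod,
    PiTensorProduct.lift.tprod, Equiv.symm_symm, MultilinearMap.compLinearMap_apply,
    MultilinearMap.mkPiAlgebra_apply]

lemma splitMap_permT (α : Equiv.Perm lam.cells) (β : Equiv.Perm (Fin (n - lam.card)))
    (t : Tens (tilde lam n h) V) :
    splitMap hone hU h (permT _ V (splitPerm h α β) t) =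
      (permT lam U α).lTensor _ (splitMap hone hU h t) := by
  have : splitMap hone hU h ∘ₗ permT _ V (splitPerm h α β) =
      (permT lam U α).lTensor _ ∘ₗ splitMap hone hU h := by
    apply PiTensorProduct.ext
    ext x
    simp only [LinearMap.compMultilinearMap_apply, LinearMap.comp_apply, permT_tprod,
      splitMap_tprod, LinearMap.lTensor_tmul]
    congr 1
    · exact Fintype.prod_equiv β.symm _ _ fun j => by rw [splitPerm_symm_inr]
    · congr 1
      funext c
      rw [splitPerm_symm_inl]
  exact LinearMap.congr_fun this t

lemma splitMap_tensMap (g : UAut one) (t : Tens (tilde lam n h) V) :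
    splitMap hone hU h (tensMap _ (autLin g) t) =
      TensorProduct.map (symAct hone hU g).toLinearMap (tensMap lam (linPart hU g))
        (splitMap hone hU h t) := by
  have : splitMap hone hU h ∘ₗ tensMap _ (autLin g) =
      TensorProduct.map (symAct hone hU g).toLinearMap (tensMap lam (linPart hU g)) ∘ₗ
        splitMap hone hU h := by
    apply PiTensorProduct.ext
    ext x
    simp only [LinearMap.compMultilinearMap_apply, LinearMap.comp_apply, tensMap_tprod,
      splitMap_tprod, TensorProduct.map_tmul, AlgHom.toLinearMap_apply, map_prod, symAct_toSym,
      linPart_toU]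
  exact LinearMap.congr_fun this t

/-- The row group of `λ̃(n)` is the product of the row group of `λ` and the symmetric group of the first
row, which acts trivially on the first tensor factor `SU`. -/
lemma splitMap_rowSym (t : Tens (tilde lam n h) V) :
    splitMap hone hU h (rowSym _ V t) =
      ((n - lam.card).factorial : ℂ) • (rowSym lam U).lTensor _ (splitMap hone hU h t) := by
  have h1 : ∑ σ ∈ rowGroup (tilde lam n h), splitMap hone hU h (permT _ V σ t) =
      ∑ p ∈ rowGroup lam ×ˢ (Finset.univ : Finset (Equiv.Perm (Fin (n - lam.card)))),
        (permT lam U p.1).lTensor (SymmetricAlgebra ℂ U) (splitMap hone hU h t) := by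
    symm
    refine Finset.sum_bij (fun p _ => splitPerm h p.1 p.2) (fun p hp => ?_)
      (fun p _ q _ he => splitPerm_injective h he) (fun σ hσ => ?_) (fun p _ => ?_)
    · exact (splitPerm_mem_rowGroup h _ _).2 (Finset.mem_product.1 hp).1
    · obtain ⟨α, β, rfl⟩ := exists_splitPerm h (σ := σ) fun c => by
        rw [(mem_rowGroup _).1 hσ]
        simp
      exact ⟨(α, β), by simpa using (splitPerm_mem_rowGroup h _ _).1 hσ, rfl⟩
    · rw [splitMap_permT]
  rw [rowSym, LinearMap.sum_apply, map_sum, h1, Finset.sum_product_right]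
  simp only [rowSym, ← LinearMap.coe_lTensorHom, map_sum, LinearMap.sum_apply]
  rw [Finset.sum_const, Finset.card_univ, Fintype.card_perm, Fintype.card_fin,
    Nat.cast_smul_eq_nsmul]

lemma lTensor_colAnti_splitMap_colAnti (t : Tens (tilde lam n h) V) :
    (colAnti lam U).lTensor _ (splitMap hone hU h (colAnti _ V t)) =
      ((colGroup lam).card : ℂ) • splitMap hone hU h (colAnti _ V t) := by
  rw [colAnti, ← LinearMap.coe_lTensorHom, map_sum, LinearMap.sum_apply,
    Finset.sum_congr rfl fun α hα => ?_, Finset.sum_const, Nat.cast_smul_eq_nsmul]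
  have h1 := permT_colAnti _ ((splitPerm_mem_colGroup h α 1).2 ⟨hα, rfl⟩) t
  rw [map_smul, LinearMap.smul_apply, LinearMap.coe_lTensorHom, ← splitMap_permT hone hU h α 1, h1,
    map_smul, smul_smul, sign_splitPerm]
  rcases Int.units_eq_one_or (Equiv.Perm.sign α) with h | h <;> simp [h]

lemma toSym_one : toSym hone hU one = 1 := by
  simp [toSym, coord_one, toU_one]

/-- If the vectors in the first row of `λ̃(n)` are all equal to `𝟙`, then a column permutation
contributes only if it fixes the first row, since `𝟙` projects to `0` in `U`. -/
lemma splitMap_colAnti_withOnes (w : lam.cells → U) :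
    splitMap hone hU h (colAnti _ V (tprod ℂ (withOnes one h w))) =
      1 ⊗ₜ[ℂ] colAnti lam U (tprod ℂ w) := by
  have hw : ∀ c, withOnes one h w (splitCells h (Sum.inl c)) = w c := fun _ => rfl
  have hx : ∀ j, withOnes one h w (splitCells h (Sum.inr j)) = one := fun _ => rfl
  have hs : splitMap hone hU h (tprod ℂ (withOnes one h w)) = 1 ⊗ₜ[ℂ] tprod ℂ w := by
    rw [splitMap_tprod]
    simp [hw, hx, toU_coe, toSym_one]
  rw [colAnti, colAnti, LinearMap.sum_apply, LinearMap.sum_apply, map_sum, TensorProduct.tmul_sum]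
  symm
  refine Finset.sum_of_injOn (fun α => splitPerm h α 1) ?_ ?_ ?_ ?_
  · intro α _ α' _ he
    exact congrArg Prod.fst (@splitPerm_injective _ _ h (α, 1) (α', 1) he)
  · intro α hα
    exact (splitPerm_mem_colGroup h α 1).2 ⟨hα, rfl⟩
  · intro τ hτ hn
    have hex : ∃ c : lam.cells, (τ.symm (splitCells h (Sum.inl c))).1.1 = 0 := by
      by_contra hno
      push Not at hno
      obtain ⟨α, β, he⟩ := exists_splitPerm h hno
      have he' : τ = splitPerm h α.symm β.symm := by
        rw [← τ.symm_symm, ← he]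
        rfl
      rw [he', splitPerm_mem_colGroup] at hτ
      exact hn ⟨α.symm, hτ.1, by rw [he', hτ.2]⟩
    obtain ⟨c, hc⟩ := hex
    obtain ⟨d | j, hd⟩ := (splitCells h).surjective (τ.symm (splitCells h (Sum.inl c)))
    · simp [← hd] at hc
    rw [LinearMap.smul_apply, permT_tprod, map_smul, splitMap_tprod]
    have h0 : (tprod ℂ fun c => toU hU (withOnes one h w (τ.symm (splitCells h (Sum.inl c))))) =
        (0 : Tens lam U) := by
      refine MultilinearMap.map_coord_zero _ c ?_
      rw [← hd, hx, toU_one]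
    rw [h0, TensorProduct.tmul_zero, smul_zero]
  · intro α _
    rw [LinearMap.smul_apply, LinearMap.smul_apply, map_smul, splitMap_permT, hs,
      LinearMap.lTensor_tmul, sign_splitPerm, TensorProduct.tmul_smul]
    simp

end SplitMap

/-! ### The homomorphism `𝕊^{λ̃(n)} V → E_λ` -/

section ToE

variable {V : Type*} [AddCommGroup V] [Module ℂ V] {one : V} (hone : one ≠ 0)
variable {U : Submodule ℂ V} (hU : IsCompl (ℂ ∙ one) U)
variable {lam : YoungDiagram} {n : ℕ} (h : lam.card + lam.rowLen 0 ≤ n)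

/-- The inclusion `E_λ = SU ⊗ 𝕊^λ U ⊆ SU ⊗ U^{⊗ |λ|}`. -/
def inclE (lam : YoungDiagram) (U : Submodule ℂ V) : ESpace lam U →ₗ[ℂ] SymmetricAlgebra ℂ U ⊗[ℂ] Tens lam U :=
  (schur lam U).subtype.lTensor _

lemma inclE_injective : Function.Injective (inclE lam U) :=
  Module.Flat.lTensor_preserves_injective_linearMap _ (Submodule.injective_subtype _)

lemma inclE_lTensor_schurMk (z : SymmetricAlgebra ℂ U ⊗[ℂ] Tens lam U) :
    inclE lam U ((schurMk lam).lTensor _ z) =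
      (rowSym lam U).lTensor _ ((colAnti lam U).lTensor _ z) := by
  rw [inclE, ← LinearMap.comp_apply, ← LinearMap.lTensor_comp, ← LinearMap.comp_apply,
    ← LinearMap.lTensor_comp]
  rfl

lemma inclE_ERep (g : UAut one) (z : ESpace lam U) :
    inclE lam U (ERep lam hone hU g z) =
      TensorProduct.map (symAct hone hU g).toLinearMap (tensMap lam (linPart hU g))
        (inclE lam U z) := by
  induction z using TensorProduct.induction_on with
  | zero => simp
  | add a b ha hb => rw [map_add, map_add, ha, hb, map_add, map_add]
  | tmul p y => rfl

lemma exists_schurRetract (lam : YoungDiagram) (U : Submodule ℂ V) :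
    ∃ r : Tens lam U →ₗ[ℂ] schur lam U, r ∘ₗ (schur lam U).subtype = LinearMap.id := by
  obtain ⟨q, hq⟩ := Submodule.exists_isCompl (schur lam U)
  exact ⟨Submodule.projectionOnto _ _ hq, by ext x; simp⟩

/-- A linear projection of `U^{⊗ |λ|}` onto `𝕊^λ U`. -/
def schurRetract (lam : YoungDiagram) (U : Submodule ℂ V) : Tens lam U →ₗ[ℂ] schur lam U :=
  (exists_schurRetract lam U).choose

lemma schurRetract_comp : schurRetract lam U ∘ₗ (schur lam U).subtype = LinearMap.id :=
  (exists_schurRetract lam U).choose_spec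

/-- The normalized homomorphism `𝕊^{λ̃(n)} V → E_λ`: the restriction of `splitMap`, divided by
`(n - |λ|)!`. The restriction takes values in `SU ⊗ 𝕊^λ U` (see `inclE_toE`); composition with a
projection to this subspace is only a means to express this. -/
def toE : schur (tilde lam n h) V →ₗ[ℂ] ESpace lam U :=
  (((n - lam.card).factorial : ℂ)⁻¹) •
    ((schurRetract lam U).lTensor _ ∘ₗ splitMap hone hU h ∘ₗ (schur (tilde lam n h) V).subtype)

lemma colGroup_card_ne_zero (μ : YoungDiagram) : ((colGroup μ).card : ℂ) ≠ 0 := by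
  have : (1 : Equiv.Perm μ.cells) ∈ colGroup μ := by simp [colGroup]
  exact_mod_cast Finset.card_ne_zero_of_mem this

lemma factorial_cast_ne_zero (m : ℕ) : (m.factorial : ℂ) ≠ 0 :=
  Nat.cast_ne_zero.2 m.factorial_ne_zero

lemma splitMap_schurMk (t : Tens (tilde lam n h) V) :
    splitMap hone hU h (schurMk _ t : Tens (tilde lam n h) V) =
      ((n - lam.card).factorial : ℂ) •
        (rowSym lam U).lTensor _ (splitMap hone hU h (colAnti _ V t)) :=
  splitMap_rowSym hone hU h _

lemma inclE_toE (y : schur (tilde lam n h) V) :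
    inclE lam U (toE hone hU h y) =
      (((n - lam.card).factorial : ℂ)⁻¹) • splitMap hone hU h (y : Tens (tilde lam n h) V) := by
  have hr : ∃ z, splitMap hone hU h (y : Tens (tilde lam n h) V) = inclE lam U z := by
    obtain ⟨t, rfl⟩ := schurMk_surjective _ y
    -- `b_λ² = |C_λ| b_λ` for the column group `C_λ`, so the factor `b_λ` can be split off.
    refine ⟨(((n - lam.card).factorial : ℂ) * ((colGroup lam).card : ℂ)⁻¹) •
      (schurMk lam).lTensor _ (splitMap hone hU h (colAnti _ V t)), ?_⟩
    rw [splitMap_schurMk, map_smul, inclE_lTensor_schurMk, lTensor_colAnti_splitMap_colAnti,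
      map_smul, smul_smul, inv_mul_cancel_right₀ (colGroup_card_ne_zero lam)]
  obtain ⟨z, hz⟩ := hr
  have h1 : (schurRetract lam U).lTensor (SymmetricAlgebra ℂ U) (inclE lam U z) = z := by
    rw [inclE, ← LinearMap.comp_apply, ← LinearMap.lTensor_comp, schurRetract_comp,
      LinearMap.lTensor_id, LinearMap.id_apply]
  simp only [toE, LinearMap.smul_apply, LinearMap.comp_apply, Submodule.subtype_apply, map_smul]
  rw [hz, h1]

lemma inclE_toE_schurMk (t : Tens (tilde lam n h) V) :
    inclE lam U (toE hone hU h (schurMk _ t)) =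
      (rowSym lam U).lTensor _ (splitMap hone hU h (colAnti _ V t)) := by
  rw [inclE_toE, splitMap_schurMk, inv_smul_smul₀ (factorial_cast_ne_zero _)]

lemma toE_normalized : IsNormalized one h (toE hone hU h) := by
  intro w
  apply inclE_injective
  rw [inclE_toE_schurMk, splitMap_colAnti_withOnes]
  rfl

lemma toE_equivariant (g : UAut one) (y : schur (tilde lam n h) V) :
    toE hone hU h (schurRep one _ g y) = ERep lam hone hU g (toE hone hU h y) := by
  apply inclE_injective
  rw [inclE_ERep, inclE_toE, inclE_toE, map_smul, ← splitMap_tensMap]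
  rfl

lemma splitMap_appendT (t : Tens (tilde lam n h) V) (v : V) :
    splitMap hone hU (Nat.le_succ_of_le h) (appendT h (t ⊗ₜ v)) =
      (LinearMap.mulLeft ℂ (toSym hone hU v)).rTensor _ (splitMap hone hU h t) := by
  have hm : n + 1 - lam.card = n - lam.card + 1 := by omega
  have : splitMap hone hU (Nat.le_succ_of_le h) ∘ₗ
      (appendT h ∘ₗ (TensorProduct.mk ℂ _ V).flip v) =
        (LinearMap.mulLeft ℂ (toSym hone hU v)).rTensor _ ∘ₗ splitMap hone hU h := by
    apply PiTensorProduct.ext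
    ext x
    simp only [LinearMap.compMultilinearMap_apply, LinearMap.comp_apply, LinearMap.flip_apply,
      TensorProduct.mk_apply, appendT_tprod, splitMap_tprod, LinearMap.rTensor_tmul,
      LinearMap.mulLeft_apply]
    congr 1
    · rw [← Fin.prod_congr' _ hm.symm, Fin.prod_univ_castSucc, mul_comm]
      have h1 : ∀ j : Fin (n - lam.card),
          splitCells (Nat.le_succ_of_le h) (Sum.inr (Fin.cast hm.symm j.castSucc)) =
            addCell h (Sum.inl (splitCells h (Sum.inr j))) := fun j => rfl
      have h2 : splitCells (Nat.le_succ_of_le h) (Sum.inr (Fin.cast hm.symm (Fin.last _))) =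
            addCell h (Sum.inr ()) := rfl
      simp only [h1, h2, Equiv.symm_apply_apply, Sum.elim_inl, Sum.elim_inr]
    · congr 1
      funext c
      have h1 : splitCells (Nat.le_succ_of_le h) (Sum.inl c) =
          addCell h (Sum.inl (splitCells h (Sum.inl c))) := rfl
      rw [h1, Equiv.symm_apply_apply, Sum.elim_inl]
  exact LinearMap.congr_fun this t

lemma lTensor_rTensor_apply {P P' Q Q' : Type*} [AddCommMonoid P] [Module ℂ P] [AddCommMonoid P']
    [Module ℂ P'] [AddCommMonoid Q] [Module ℂ Q] [AddCommMonoid Q'] [Module ℂ Q'] (f : P →ₗ[ℂ] P')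
    (g : Q →ₗ[ℂ] Q') (z : P ⊗[ℂ] Q) : g.lTensor P' (f.rTensor Q z) = f.rTensor Q' (g.lTensor P z) := by
  induction z using TensorProduct.induction_on with
  | zero => simp
  | add a b ha hb => simp only [map_add, ha, hb]
  | tmul p y => simp

/-- The projection `𝕊^{λ̃(n)} V ⊗ V → 𝕊^{λ̃(n+1)} V` corresponds to multiplication in `SU`. -/
lemma toE_schurProj (y : schur (tilde lam n h) V) (v : V) :
    toE hone hU (Nat.le_succ_of_le h) (schurProj h (y ⊗ₜ v)) =
      (LinearMap.mulLeft ℂ (toSym hone hU v)).rTensor _ (toE hone hU h y) := by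
  obtain ⟨t, rfl⟩ := schurMk_surjective _ y
  apply inclE_injective
  have hcomm : ∀ z : ESpace lam U,
      inclE lam U ((LinearMap.mulLeft ℂ (toSym hone hU v)).rTensor _ z) =
        (LinearMap.mulLeft ℂ (toSym hone hU v)).rTensor _ (inclE lam U z) := fun z =>
    lTensor_rTensor_apply _ _ z
  rw [hcomm, schurProj_mk, inclE_toE_schurMk, inclE_toE_schurMk,
    colAnti_appendT, splitMap_appendT, lTensor_rTensor_apply]

lemma toE_stab (y : schur (tilde lam n h) V) :
    toE hone hU (Nat.le_succ_of_le h) (stab h one y) = toE hone hU h y := by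
  refine (toE_schurProj hone hU h y one).trans ?_
  rw [toSym_one, LinearMap.mulLeft_one, LinearMap.rTensor_id, LinearMap.id_apply]

end ToE

/-! ### Evaluation of elements of `E_λ` at points of `U^*` -/

section Evaluation

variable {V : Type*} [AddCommGroup V] [Module ℂ V] {one : V} (hone : one ≠ 0)
variable {U : Submodule ℂ V} (hU : IsCompl (ℂ ∙ one) U)
variable {lam : YoungDiagram} {n : ℕ} (h : lam.card + lam.rowLen 0 ≤ n)

/-- Evaluation of elements of `SU`, as polynomial functions on `U^*`, at the point `θ`. -/
def evalAt (θ : Dual ℂ U) : SymmetricAlgebra ℂ U →ₐ[ℂ] ℂ := SymmetricAlgebra.lift θ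

lemma evalAt_toSym (θ : Dual ℂ U) (v : V) :
    evalAt θ (toSym hone hU v) = coord hone hU v + θ (toU hU v) := by
  simp [evalAt, toSym, SymmetricAlgebra.lift_ι_apply]

/-- Evaluation `SU ⊗ W → W` at the point `θ` of `U^*`. -/
def evalTens (θ : Dual ℂ U) (W : Type*) [AddCommGroup W] [Module ℂ W] :
    SymmetricAlgebra ℂ U ⊗[ℂ] W →ₗ[ℂ] W :=
  (TensorProduct.lid ℂ W).toLinearMap ∘ₗ (evalAt θ).toLinearMap.rTensor W

@[simp] lemma evalTens_tmul (θ : Dual ℂ U) {W : Type*} [AddCommGroup W] [Module ℂ W]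
    (p : SymmetricAlgebra ℂ U) (w : W) : evalTens θ W (p ⊗ₜ w) = evalAt θ p • w := by
  simp [evalTens]

lemma evalTens_inclE (θ : Dual ℂ U) (z : ESpace lam U) :
    evalTens θ (Tens lam U) (inclE lam U z) = (evalTens θ (schur lam U) z : Tens lam U) := by
  induction z using TensorProduct.induction_on with
  | zero => simp
  | add a b ha hb => rw [map_add, map_add, ha, hb, map_add, Submodule.coe_add]
  | tmul p y => simp [inclE]

/-- A polynomial function on `U^*` that vanishes at all points is zero; also with vector values. -/
lemma eq_zero_of_forall_evalTens {W : Type*} [AddCommGroup W] [Module ℂ W]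
    {z : SymmetricAlgebra ℂ U ⊗[ℂ] W} (hz : ∀ θ, evalTens θ W z = 0) : z = 0 := by
  classical
  let B := Basis.ofVectorSpace ℂ W
  let C := Basis.ofVectorSpace ℂ U
  let e := SymmetricAlgebra.equivMvPolynomial C
  -- the coordinates of `z` with respect to a basis of `W` are elements of `SU`
  have key : ∀ (θ : Dual ℂ U) (i) (z : SymmetricAlgebra ℂ U ⊗[ℂ] W),
      B.coord i (evalTens θ W z) =
        evalAt θ (TensorProduct.rid ℂ _ ((B.coord i).lTensor (SymmetricAlgebra ℂ U) z)) := by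
    intro θ i z
    induction z using TensorProduct.induction_on with
    | zero => simp
    | add a b ha hb => simp only [map_add, ha, hb]
    | tmul p y => simp [mul_comm]
  have hev : ∀ (s : _ → ℂ) (p : SymmetricAlgebra ℂ U),
      MvPolynomial.eval s (e p) = evalAt (C.constr ℂ s) p := by
    intro s p
    have : (MvPolynomial.aeval s).comp e.toAlgHom = evalAt (C.constr ℂ s) := by
      apply SymmetricAlgebra.algHom_ext
      apply C.ext
      intro i
      simp [evalAt, e]
    exact DFunLike.congr_fun this p
  have hcoord : ∀ i, TensorProduct.rid ℂ _ ((B.coord i).lTensor (SymmetricAlgebra ℂ U) z) = 0 := by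
    intro i
    apply e.injective
    rw [map_zero]
    apply MvPolynomial.funext
    intro s
    rw [hev, ← key, hz, map_zero, map_zero]
  let D := TensorProduct.equivFinsuppOfBasisRight (M := SymmetricAlgebra ℂ U) B
  apply D.injective
  rw [map_zero]
  ext1 i
  have : ∀ z, D z i = TensorProduct.rid ℂ _ ((B.coord i).lTensor (SymmetricAlgebra ℂ U) z) := by
    intro z
    induction z using TensorProduct.induction_on with
    | zero => simp
    | add a b ha hb => simp only [map_add, Finsupp.add_apply, ha, hb]
    | tmul p y => simp [D]
  rw [this, hcoord]
  rfl

/-- The functionals on `V` that are `z (coord + θ)` for row `0`, and extensions by zero of functionals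
`ζ i` on `U` for the other rows. -/
def extFunctionals (z : ℂ) (θ : Dual ℂ U) (ζ : ℕ → Dual ℂ U) : ℕ → Dual ℂ V
  | 0 => z • (coord hone hU + θ ∘ₗ toU hU)
  | i + 1 => ζ i ∘ₗ toU hU

lemma rowPair_extFunctionals (z : ℂ) (θ : Dual ℂ U) (ζ : ℕ → Dual ℂ U)
    (t : Tens (tilde lam n h) V) :
    rowPair _ (extFunctionals hone hU z θ ζ) t =
      z ^ (n - lam.card) * rowPair lam ζ (evalTens θ _ (splitMap hone hU h t)) := by
  have : rowPair _ (extFunctionals hone hU z θ ζ) =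
      z ^ (n - lam.card) • (rowPair lam ζ ∘ₗ evalTens θ _ ∘ₗ splitMap hone hU h) := by
    apply PiTensorProduct.ext
    ext x
    simp only [LinearMap.compMultilinearMap_apply, LinearMap.smul_apply, LinearMap.comp_apply,
      splitMap_tprod, evalTens_tmul, map_smul, pair_tprod, map_prod, evalAt_toSym, smul_eq_mul]
    rw [← (splitCells h).prod_comp, Fintype.prod_sum_type, mul_comm, ← mul_assoc]
    congr 1
    simp only [extFunctionals, splitCells_inr, LinearMap.smul_apply, LinearMap.add_apply,
      LinearMap.comp_apply, smul_eq_mul, Finset.prod_mul_distrib, Finset.prod_const,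
      Finset.card_univ, Fintype.card_fin]
  exact LinearMap.congr_fun this t

lemma rowPair_extFunctionals_schur (z : ℂ) (θ : Dual ℂ U) (ζ : ℕ → Dual ℂ U)
    (y : schur (tilde lam n h) V) :
    rowPair _ (extFunctionals hone hU z θ ζ) (y : Tens (tilde lam n h) V) =
      z ^ (n - lam.card) * (n - lam.card).factorial *
        rowPair lam ζ (evalTens θ (schur lam U) (toE hone hU h y) : Tens lam U) := by
  have h1 : splitMap hone hU h (y : Tens (tilde lam n h) V) =
      ((n - lam.card).factorial : ℂ) • inclE lam U (toE hone hU h y) := by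
    rw [inclE_toE, smul_inv_smul₀ (factorial_cast_ne_zero _)]
  rw [rowPair_extFunctionals, h1, map_smul, map_smul, evalTens_inclE, smul_eq_mul, mul_assoc]

/-- The kernel of `toE` is zero. By column antisymmetry, `rowPair ξ` does not change on `𝕊^{λ̃(n)} V` when
multiples of `ξ 0` are added to the other functionals. If `ξ 0` does not vanish on `𝟙`, all other
functionals can in this way be made to vanish on `𝟙`, and then `rowPair ξ` factors through `toE`. -/
lemma toE_injective : Function.Injective (toE hone hU h) := by
  rw [injective_iff_map_eq_zero]
  intro y hy
  have hne : ∀ ξ : ℕ → Dual ℂ V, ξ 0 one ≠ 0 → rowPair _ ξ (y : Tens (tilde lam n h) V) = 0 := by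
    intro ξ hξ
    let a : ℕ → ℂ := fun i => if i = 0 then 0 else -(ξ i one / ξ 0 one)
    let ξ' : ℕ → Dual ℂ V := fun i => a i • ξ 0 + ξ i
    have h1 : rowPair _ ξ (y : Tens (tilde lam n h) V) = rowPair _ ξ' (y : Tens (tilde lam n h) V) := by
      obtain ⟨t, rfl⟩ := schurMk_surjective _ y
      rw [rowPair_schurMk, rowPair_schurMk, rowPair_colAnti_shear _ ξ a (if_pos rfl)]
    have h2 : ξ' = extFunctionals hone hU (ξ 0 one) ((ξ 0 one)⁻¹ • (ξ 0 ∘ₗ U.subtype))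
        fun i => ξ' (i + 1) ∘ₗ U.subtype := by
      funext i
      rcases i with _ | i
      · ext v
        conv_lhs => rw [← coord_add_toU hone hU v]
        simp [ξ', a, extFunctionals, mul_inv_cancel_left₀ hξ, mul_comm]
      · ext v
        have h3 : ξ' (i + 1) one = 0 := by
          simp [ξ', a, div_mul_cancel₀ _ hξ]
        conv_lhs => rw [← coord_add_toU hone hU v, map_add, map_smul, h3]
        simp [extFunctionals]
    rw [h1, h2, rowPair_extFunctionals_schur, hy, map_zero, Submodule.coe_zero, map_zero, mul_zero]
  refine schur_eq_zero_of_forall_rowPair _ fun ξ => ?_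
  -- Perturb `ξ 0` by a multiple of the coordinate along `𝟙`.
  obtain ⟨P, hP⟩ := exists_polynomial_multilinear_line (pairAt _ (y : Tens (tilde lam n h) V))
    (fun c => if c.1.1 = 0 then coord hone hU else 0) (fun c => ξ c.1.1)
  have h0 : P.eval 0 = 0 := by
    have := eval_eq_of_forall_mem_infinite P 0 (S := {-(ξ 0 one)}ᶜ)
      (Set.finite_singleton _).infinite_compl (fun r hr => ?_) 0
    · simpa using this
    · rw [← hP, Polynomial.eval_zero]
      have h3 := hne (fun i => r • (if i = 0 then coord hone hU else 0) + ξ i) (by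
        simp only [if_true, LinearMap.add_apply, LinearMap.smul_apply, coord_one, smul_eq_mul,
          mul_one]
        exact fun h4 => hr (by rw [Set.mem_singleton_iff, eq_neg_iff_add_eq_zero, h4]))
      exact h3
  rw [← hP] at h0
  simpa [pairAt_apply] using h0

lemma stab_injective {one : V} (hone : one ≠ 0) : Function.Injective (stab h one) := by
  obtain ⟨U, hU⟩ := Submodule.exists_isCompl (ℂ ∙ one)
  intro y y' he
  apply toE_injective hone hU h
  rw [← toE_stab, he, toE_stab]

end Evaluation

/-! ### Highest weight vectors -/

section HighestWeight

variable (μ : YoungDiagram) {W : Type*} [AddCommGroup W] [Module ℂ W]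

lemma row_lt_colLen_zero (c : μ.cells) : c.1.1 < μ.colLen 0 := by
  have hc : (c.1.1, c.1.2) ∈ μ := c.2
  exact YoungDiagram.mem_iff_lt_colLen.1 (μ.up_left_mem le_rfl (Nat.zero_le _) hc)

lemma exists_dual_families {k : ℕ} (hr : (k : Cardinal) ≤ Module.rank ℂ W) :
    ∃ (e : ℕ → W) (ξ : ℕ → Dual ℂ W), ∀ i < k, ∀ j < k, ξ i (e j) = if i = j then 1 else 0 := by
  obtain ⟨f, hf⟩ := Module.le_rank_iff_exists_linearMap.1 hr
  obtain ⟨g, hg⟩ := LinearMap.exists_leftInverse_of_injective f (LinearMap.ker_eq_bot.2 hf)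
  refine ⟨fun i => if hi : i < k then f (Pi.single ⟨i, hi⟩ 1) else 0,
    fun i => if hi : i < k then LinearMap.proj ⟨i, hi⟩ ∘ₗ g else 0, fun i hi j hj => ?_⟩
  have := LinearMap.congr_fun hg (Pi.single ⟨j, hj⟩ 1)
  simp only [LinearMap.comp_apply, LinearMap.id_apply] at this
  simp [hi, hj, this, Pi.single_apply]

lemma exists_highestWeight_ne_zero (hr : (μ.colLen 0 : Cardinal) ≤ Module.rank ℂ W) :
    ∃ e : ℕ → W, schurMk μ (tprod ℂ fun c => e c.1.1) ≠ 0 := by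
  obtain ⟨e, ξ, he⟩ := exists_dual_families hr
  refine ⟨e, fun h0 => rowGroup_card_ne_zero μ ?_⟩
  have h1 := rowPair_schurMk μ ξ (tprod ℂ fun c => e c.1.1)
  rw [h0, Submodule.coe_zero, map_zero] at h1
  -- Only the trivial column permutation contributes to the value at `b_μ (e 0 ⊗ ⋯)`.
  have h2 : rowPair μ ξ (colAnti μ W (tprod ℂ fun c => e c.1.1)) = 1 := by
    rw [colAnti, LinearMap.sum_apply, map_sum, Finset.sum_eq_single 1]
    · simp only [LinearMap.smul_apply, permT_tprod, map_smul, pair_tprod]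
      rw [Finset.prod_eq_one]
      · simp
      · intro c _
        exact (he _ (row_lt_colLen_zero μ c) _ (row_lt_colLen_zero μ c)).trans (if_pos rfl)
    · intro τ hτ hne
      simp only [LinearMap.smul_apply, permT_tprod, map_smul, pair_tprod]
      have hex : ∃ c, (τ.symm c).1.1 ≠ c.1.1 := by
        by_contra hno
        push Not at hno
        apply hne
        rw [← inv_eq_one]
        ext1 c
        refine Subtype.ext (Prod.ext (hno c) ?_)
        have := (mem_colGroup μ).1 hτ (τ.symm c)
        rw [Equiv.apply_symm_apply] at this
        exact this.symm
      obtain ⟨c, hc⟩ := hex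
      rw [Finset.prod_eq_zero (Finset.mem_univ c), smul_zero]
      rw [he _ (row_lt_colLen_zero μ c) _ (row_lt_colLen_zero μ _), if_neg hc.symm]
    · intro h
      exact absurd ((mem_colGroup μ).2 fun _ => rfl) h
  rw [h2, smul_eq_mul, mul_one] at h1
  exact h1.symm

/-- If `μ` has more rows than the dimension of `W`, then the vectors in the first column of `μ` are always
linearly dependent, so that `𝕊^μ W = 0`. -/
lemma schur_subsingleton (hr : Module.rank ℂ W < (μ.colLen 0 : Cardinal)) :
    Subsingleton (schur μ W) := by
  classical
  have hcol : colAnti μ W = 0 := by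
    apply PiTensorProduct.ext
    ext x
    have hmem : ∀ i : Fin (μ.colLen 0), ((i : ℕ), 0) ∈ μ.cells := fun i => by
      rw [YoungDiagram.mem_cells, YoungDiagram.mem_iff_lt_colLen]
      exact i.2
    let d : Fin (μ.colLen 0) → μ.cells := fun i => ⟨(i, 0), hmem i⟩
    have hdep : ¬ LinearIndependent ℂ fun i => x (d i) := fun hli => by
      refine absurd ?_ (not_le.2 hr)
      simpa using hli.cardinal_lift_le_rank
    rw [Fintype.not_linearIndependent_iff] at hdep
    obtain ⟨a, ha, i, hi⟩ := hdep
    -- Replace the vector in cell `(i, 0)` by the vanishing linear combination.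
    have h1 : colAnti μ W (tprod ℂ (Function.update x (d i) (∑ j, a j • x (d j)))) = 0 := by
      rw [ha, MultilinearMap.map_update_zero, map_zero]
    rw [MultilinearMap.map_update_sum, map_sum, Finset.sum_eq_single i] at h1
    · rw [MultilinearMap.map_update_smul, Function.update_eq_self, map_smul] at h1
      exact (smul_eq_zero.1 h1).resolve_left hi
    · intro j _ hj
      have hne : d i ≠ d j := fun h => hj (by
        have := congrArg (fun c : μ.cells => c.1.1) h
        exact (Fin.ext this).symm)
      rw [MultilinearMap.map_update_smul, map_smul,
        colAnti_tprod_eq_zero μ hne rfl (by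
          rw [Function.update_self, Function.update_of_ne hne.symm]), smul_zero]
    · simp
  refine ⟨fun y y' => ?_⟩
  have h0 : ∀ y : schur μ W, y = 0 := fun y => by
    obtain ⟨t, rfl⟩ := schurMk_surjective μ y
    exact schurMk_eq_zero_of_colAnti μ (by rw [hcol, LinearMap.zero_apply])
  rw [h0 y, h0 y']

end HighestWeight

/-! ### Elements of `Aut(V, 𝟙) = GL(U) ⋉ U^*` -/

section Group

variable {V : Type*} [AddCommGroup V] [Module ℂ V] {one : V} (hone : one ≠ 0)
variable {U : Submodule ℂ V} (hU : IsCompl (ℂ ∙ one) U)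
variable {lam : YoungDiagram}

/-- The extension of an endomorphism of `U` to `V` that fixes `𝟙`. -/
def extOne (A : U →ₗ[ℂ] U) : V →ₗ[ℂ] V :=
  (coord hone hU).smulRight one + U.subtype ∘ₗ A ∘ₗ toU hU

lemma extOne_apply (A : U →ₗ[ℂ] U) (v : V) :
    extOne hone hU A v = coord hone hU v • one + (A (toU hU v) : V) := rfl

lemma extOne_comp (A B : U →ₗ[ℂ] U) :
    extOne hone hU A ∘ₗ extOne hone hU B = extOne hone hU (A ∘ₗ B) := by
  ext v
  simp [extOne_apply, coord_one, coord_coe, toU_one, toU_coe]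

lemma extOne_id : extOne hone hU LinearMap.id = LinearMap.id := by
  ext v
  simp [extOne_apply, coord_add_toU]

/-- The inclusion `GL(U) → Aut(V, 𝟙)`. -/
def glAut (A : U ≃ₗ[ℂ] U) : UAut one :=
  ⟨LinearEquiv.ofLinearMap (extOne hone hU A) (extOne hone hU A.symm)
    (by rw [extOne_comp, LinearEquiv.comp_symm, extOne_id])
    (by rw [extOne_comp, LinearEquiv.symm_comp, extOne_id]), by
    rw [MulAction.mem_stabilizer_iff]
    change extOne hone hU A one = one
    simp [extOne_apply, coord_one, toU_one]⟩

lemma autLin_glAut (A : U ≃ₗ[ℂ] U) : autLin (glAut hone hU A) = extOne hone hU A := rfl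

/-- The linear map `v ↦ v + θ(u) 𝟙`, where `u` is the component of `v` in `U`. -/
def translate (θ : Dual ℂ U) : V →ₗ[ℂ] V := LinearMap.id + (θ ∘ₗ toU hU).smulRight one

lemma translate_comp_neg (θ θ' : Dual ℂ U) (h : θ + θ' = 0) :
    translate hU θ ∘ₗ translate hU θ' = LinearMap.id := by
  obtain rfl := eq_neg_of_add_eq_zero_left h
  ext v
  simp [translate, toU_one]

/-- The inclusion `U^* → Aut(V, 𝟙)`. -/
def dualAut (θ : Dual ℂ U) : UAut one :=
  ⟨LinearEquiv.ofLinearMap (translate hU θ) (translate hU (-θ))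
    (translate_comp_neg hU _ _ (by simp)) (translate_comp_neg hU _ _ (by simp)), by
    rw [MulAction.mem_stabilizer_iff]
    change translate hU θ one = one
    simp [translate, toU_one]⟩

lemma autLin_dualAut (θ : Dual ℂ U) : autLin (dualAut hU θ) = translate hU θ := rfl

lemma evalTens_zero_ERep (g : UAut one) (z : ESpace lam U) :
    evalTens 0 (schur lam U) (ERep lam hone hU g z) =
      schurMap lam (linPart hU g)
        (evalTens (coord hone hU ∘ₗ autLin g ∘ₗ U.subtype) (schur lam U) z) := by
  have h1 : (evalAt 0).comp (symAct hone hU g) =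
      evalAt (coord hone hU ∘ₗ autLin g ∘ₗ U.subtype) := by
    apply SymmetricAlgebra.algHom_ext
    ext u
    have h2 : symAct hone hU g (SymmetricAlgebra.ι ℂ U u) = toSym hone hU (autLin g u) := by
      rw [← toSym_coe hone hU, symAct_toSym]
    change evalAt 0 (symAct hone hU g (SymmetricAlgebra.ι ℂ U u)) =
      evalAt (coord hone hU ∘ₗ autLin g ∘ₗ U.subtype) (SymmetricAlgebra.ι ℂ U u)
    rw [h2, evalAt_toSym]
    simp [evalAt]
  induction z using TensorProduct.induction_on with
  | zero => simp
  | add a b ha hb => simp only [map_add, ha, hb]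
  | tmul p y =>
    have h2 : ERep lam hone hU g (p ⊗ₜ y) = symAct hone hU g p ⊗ₜ schurMap lam (linPart hU g) y :=
      rfl
    rw [h2, evalTens_tmul, evalTens_tmul, map_smul, ← h1]
    rfl

lemma evalTens_zero_glAut (A : U ≃ₗ[ℂ] U) (z : ESpace lam U) :
    evalTens 0 (schur lam U) (ERep lam hone hU (glAut hone hU A) z) =
      schurMap lam (A : U →ₗ[ℂ] U) (evalTens 0 (schur lam U) z) := by
  have h1 : linPart hU (glAut hone hU A) = A := by
    ext u
    simp [linPart, autLin_glAut, extOne_apply, toU_coe, coord_coe]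
  have h2 : coord hone hU ∘ₗ autLin (glAut hone hU A) ∘ₗ U.subtype = 0 := by
    ext u
    simp [autLin_glAut, extOne_apply, coord_coe]
  rw [evalTens_zero_ERep, h1, h2]

lemma evalTens_zero_dualAut (θ : Dual ℂ U) (z : ESpace lam U) :
    evalTens 0 (schur lam U) (ERep lam hone hU (dualAut hU θ) z) =
      evalTens θ (schur lam U) z := by
  have h1 : linPart hU (dualAut (one := one) hU θ) = LinearMap.id := by
    ext u
    simp [linPart, autLin_dualAut, translate, toU_one, toU_coe]
  have h2 : coord hone hU ∘ₗ autLin (dualAut hU θ) ∘ₗ U.subtype = θ := by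
    ext u
    simp [autLin_dualAut, translate, coord_coe, toU_coe, coord_one]
  rw [evalTens_zero_ERep, h1, h2, schurMap_id, LinearMap.id_apply]

/-- Frobenius reciprocity: a homomorphism to `E_λ` is determined by its composition with the evaluation
at `0`, because the evaluation at `θ` is the translation by `θ` followed by the evaluation at `0`. -/
lemma eq_of_evalTens_zero_eq {M : Type*} [AddCommGroup M] [Module ℂ M]
    {ρ : Representation ℂ (UAut one) M} (f g : ρ.IntertwiningMap (ERep lam hone hU))
    (hfg : ∀ y, evalTens 0 (schur lam U) (f y) = evalTens 0 (schur lam U) (g y)) : f = g := by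
  ext y
  refine sub_eq_zero.1 ?_
  change f y - g y = 0
  refine eq_zero_of_forall_evalTens (W := schur lam U) fun θ => ?_
  have h1 := hfg (ρ (dualAut hU θ) y)
  rw [f.isIntertwining, g.isIntertwining, evalTens_zero_dualAut, evalTens_zero_dualAut] at h1
  rw [map_sub, sub_eq_zero]
  exact h1

/-- A finite rank perturbation `r + E Ξ` of a homothety is invertible for all but finitely many `r`. -/
lemma exists_equiv_smul_add {W F : Type*} [AddCommGroup W] [Module ℂ W] [AddCommGroup F]
    [Module ℂ F] [FiniteDimensional ℂ F] (E : F →ₗ[ℂ] W) (X : W →ₗ[ℂ] F) :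
    ∃ S : Set ℂ, S.Finite ∧ ∀ r ∉ S, ∃ A : W ≃ₗ[ℂ] W,
      (A : W →ₗ[ℂ] W) = r • LinearMap.id + E ∘ₗ X := by
  refine ⟨{0} ∪ spectrum ℂ (-(X ∘ₗ E) : Module.End ℂ F),
    (Set.finite_singleton 0).union (Module.End.finite_spectrum _), fun r hr => ?_⟩
  rw [Set.mem_union, not_or] at hr
  have hr0 : r ≠ 0 := hr.1
  have hu : IsUnit (algebraMap ℂ (Module.End ℂ F) r - -(X ∘ₗ E)) := not_not.1 hr.2
  obtain ⟨u, hu⟩ := hu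
  have h1 : ∀ x : F, r • (u⁻¹).1 x + X (E ((u⁻¹).1 x)) = x := by
    intro x
    have := LinearMap.congr_fun u.mul_inv x
    rw [hu] at this
    simpa [Module.algebraMap_end_apply] using this
  have h2 : ∀ x : F, (u⁻¹).1 (r • x + X (E x)) = x := by
    intro x
    have := LinearMap.congr_fun u.inv_mul x
    rw [hu] at this
    simpa [Module.algebraMap_end_apply] using this
  -- The inverse of `r + E X` is `r⁻¹ (1 - E (r + X E)⁻¹ X)`.
  refine ⟨LinearEquiv.ofLinearMap (r • LinearMap.id + E ∘ₗ X)
    (r⁻¹ • (LinearMap.id - E ∘ₗ (u⁻¹).1 ∘ₗ X)) ?_ ?_, rfl⟩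
  · ext w
    have h3 : E (X w) - E (X (E ((u⁻¹).1 (X w)))) = r • E ((u⁻¹).1 (X w)) := by
      rw [sub_eq_iff_eq_add, ← map_smul, ← map_add, h1]
    simp only [LinearMap.comp_apply, LinearMap.add_apply, LinearMap.smul_apply, LinearMap.sub_apply,
      LinearMap.id_apply, map_smul, map_sub]
    rw [add_sub_add_comm, h3, sub_add_cancel, inv_smul_smul₀ hr0]
  · ext w
    have h3 : (u⁻¹).1 (X (r • w + E (X w))) = X w := by rw [map_add, map_smul, h2]
    simp only [LinearMap.comp_apply, LinearMap.add_apply, LinearMap.smul_apply, LinearMap.sub_apply,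
      LinearMap.id_apply]
    rw [h3, add_sub_cancel_right, inv_smul_smul₀ hr0]

end Group

/-! ### Homomorphisms to `E_λ` are multiples of the normalized one -/

section Uniqueness

/-- The functional values of a tensor power of `r T + T'` are polynomial in `r`. -/
lemma exists_polynomial_tensMap (μ : YoungDiagram) {W W' : Type*} [AddCommGroup W] [Module ℂ W]
    [AddCommGroup W'] [Module ℂ W'] (T T' : W →ₗ[ℂ] W') (l : Dual ℂ (Tens μ W')) (t : Tens μ W) :
    ∃ P : Polynomial ℂ, ∀ r : ℂ, l (tensMap μ (r • T + T') t) = P.eval r := by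
  induction t using PiTensorProduct.induction_on with
  | smul_tprod a x =>
    obtain ⟨P, hP⟩ := exists_polynomial_multilinear_line
      (l.compMultilinearMap (tprod ℂ)) (fun c => T (x c)) (fun c => T' (x c))
    refine ⟨Polynomial.C a * P, fun r => ?_⟩
    rw [Polynomial.eval_mul, Polynomial.eval_C, ← hP, map_smul, map_smul, tensMap_tprod]
    rfl
  | add a b ha hb =>
    obtain ⟨P, hP⟩ := ha
    obtain ⟨Q, hQ⟩ := hb
    exact ⟨P + Q, fun r => by rw [map_add, map_add, hP, hQ, Polynomial.eval_add]⟩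

variable {V : Type*} [AddCommGroup V] [Module ℂ V] {one : V} (hone : one ≠ 0)
variable {U : Submodule ℂ V} (hU : IsCompl (ℂ ∙ one) U)
variable {lam : YoungDiagram} {n : ℕ} (h : lam.card + lam.rowLen 0 ≤ n)

/-- A `GL(U)`-homomorphism `𝕊^{λ̃(n)} V → 𝕊^λ U` also commutes with the endomorphisms of `U` of finite rank,
since these are limits of invertible maps `r + B` in the Zariski topology. -/
lemma commute_finite_rank {φ : schur (tilde lam n h) V →ₗ[ℂ] schur lam U}
    (hφ : ∀ (A : U ≃ₗ[ℂ] U) y,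
      φ (schurMap _ (extOne hone hU A) y) = schurMap lam (A : U →ₗ[ℂ] U) (φ y))
    {F : Type*} [AddCommGroup F] [Module ℂ F] [FiniteDimensional ℂ F] (E : F →ₗ[ℂ] U)
    (X : U →ₗ[ℂ] F) (y : schur (tilde lam n h) V) :
    φ (schurMap _ (extOne hone hU (E ∘ₗ X)) y) = schurMap lam (E ∘ₗ X) (φ y) := by
  obtain ⟨S, hS, hA⟩ := exists_equiv_smul_add E X
  refine Subtype.ext (sub_eq_zero.1 (eq_zero_of_forall_pair lam fun η => ?_))
  rw [map_sub, sub_eq_zero]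
  let l : schur lam U →ₗ[ℂ] ℂ := pair lam η ∘ₗ (schur lam U).subtype
  change l (φ (schurMap _ (extOne hone hU (E ∘ₗ X)) y)) = l (schurMap lam (E ∘ₗ X) (φ y))
  obtain ⟨t, rfl⟩ := schurMk_surjective _ y
  obtain ⟨t', ht'⟩ := schurMk_surjective _ (φ (schurMk _ t))
  obtain ⟨P, hP⟩ := exists_polynomial_tensMap _ (U.subtype ∘ₗ toU hU) (extOne hone hU (E ∘ₗ X))
    (l ∘ₗ φ ∘ₗ schurMk _) t
  obtain ⟨Q, hQ⟩ := exists_polynomial_tensMap _ LinearMap.id (E ∘ₗ X) (l ∘ₗ schurMk _) t'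
  have hPQ := eval_eq_of_forall_mem_infinite P Q hS.infinite_compl (fun r hr => ?_) 0
  · rw [← hP, ← hQ, zero_smul, zero_smul, zero_add, zero_add] at hPQ
    simp only [LinearMap.comp_apply] at hPQ
    rw [← schurMap_schurMk, ← schurMap_schurMk, ht'] at hPQ
    exact hPQ
  · obtain ⟨A, hAr⟩ := hA r hr
    have h1 : extOne hone hU A = r • (U.subtype ∘ₗ toU hU) + extOne hone hU (E ∘ₗ X) := by
      ext v
      simp only [hAr, extOne_apply, LinearMap.add_apply, LinearMap.smul_apply, LinearMap.comp_apply,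
        LinearMap.id_apply, Submodule.coe_add, Submodule.coe_smul, Submodule.subtype_apply]
      abel
    have h2 := congrArg l (hφ A (schurMk _ t))
    rw [← ht', schurMap_schurMk, schurMap_schurMk, h1, hAr] at h2
    rw [← hP, ← hQ]
    exact h2

/-- The vectors `𝟙, e 0, e 1, …`. -/
def consOne (one : V) (e : ℕ → U) : ℕ → V
  | 0 => one
  | i + 1 => e i

lemma card_row_succ (i : ℕ) :
    (Finset.univ.filter fun c : (tilde lam n h).cells => c.1.1 = i + 1).card =
      (Finset.univ.filter fun c : lam.cells => c.1.1 = i).card := by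
  symm
  refine Finset.card_bij (fun c _ => splitCells h (Sum.inl c)) (fun c hc => ?_)
    (fun c _ c' _ he => by simpa using he) fun c hc => ?_
  · simpa using hc
  · obtain ⟨d | j, rfl⟩ := (splitCells h).surjective c
    · exact ⟨d, by simpa using hc, rfl⟩
    · simp at hc

/-- The content of a filling of `λ̃(n)` is determined by the multiplicities of the positive entries. -/
lemma content_tilde_iff {k : ℕ} (hk : ∀ c : lam.cells, c.1.1 < k)
    (x : (tilde lam n h).cells → Fin (k + 1)) :
    ((fun i : Fin k => (Finset.univ.filter fun c => x c = i.succ).card) =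
        fun i : Fin k => (Finset.univ.filter fun c : lam.cells => c.1.1 = i).card) ↔
      ∀ i : Fin (k + 1), (Finset.univ.filter fun c => x c = i).card =
        (Finset.univ.filter fun c : (tilde lam n h).cells => c.1.1 = i).card := by
  constructor
  · intro hx
    have hsucc : ∀ i : Fin k, (Finset.univ.filter fun c => x c = i.succ).card =
        (Finset.univ.filter fun c : (tilde lam n h).cells => c.1.1 = i.succ).card := fun i => by
      rw [Fin.val_succ, card_row_succ]
      exact congrFun hx i
    have hlt : ∀ c : (tilde lam n h).cells, c.1.1 < k + 1 := fun c => by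
      obtain ⟨d | j, rfl⟩ := (splitCells h).surjective c
      · simpa using hk d
      · simp
    -- both totals are the number of cells
    have h1 := Finset.card_eq_sum_card_fiberwise (f := x)
      (s := (Finset.univ : Finset (tilde lam n h).cells)) (t := Finset.univ) (by intro c; simp)
    have h2 := Finset.card_eq_sum_card_fiberwise
      (f := fun c : (tilde lam n h).cells => (⟨c.1.1, hlt c⟩ : Fin (k + 1)))
      (s := (Finset.univ : Finset (tilde lam n h).cells)) (t := Finset.univ) (by intro c; simp)
    simp only [Fin.ext_iff] at h2
    rw [h1, Fin.sum_univ_succ, Fin.sum_univ_succ, Finset.sum_congr rfl fun i _ => hsucc i,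
      Nat.add_right_cancel_iff] at h2
    intro i
    refine Fin.cases ?_ ?_ i
    · exact h2
    · exact hsucc
  · intro hx
    funext i
    rw [hx, Fin.val_succ, card_row_succ]

lemma extOne_sum {k : ℕ} (s : Fin k → ℂ) (ξ : ℕ → Dual ℂ U) (e : ℕ → U) :
    extOne hone hU (∑ i : Fin k, s i • (ξ i).smulRight (e i)) =
      ∑ i : Fin (k + 1), (Fin.cons 1 s : Fin (k + 1) → ℂ) i •
        (extFunctionals hone hU 1 0 ξ i).smulRight (consOne one e i) := by
  ext v
  rw [Fin.sum_univ_succ, extOne_apply]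
  simp [extFunctionals, consOne, LinearMap.sum_apply]

/-- Comparison of the components of weight `λ` on both sides of the equivariance of `φ`. -/
lemma rowPair_smul_highestWeight {φ : schur (tilde lam n h) V →ₗ[ℂ] schur lam U}
    (hφ : ∀ (A : U ≃ₗ[ℂ] U) y,
      φ (schurMap _ (extOne hone hU A) y) = schurMap lam (A : U →ₗ[ℂ] U) (φ y))
    (ξ : ℕ → Dual ℂ U) (e : ℕ → U) (t : Tens (tilde lam n h) V) (t' : Tens lam U)
    (ht : φ (schurMk _ t) = schurMk _ t') :
    rowPair _ (extFunctionals hone hU 1 0 ξ) (colAnti _ V t) •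
        φ (schurMk _ (tprod ℂ fun c => consOne one e c.1.1)) =
      rowPair _ ξ (colAnti _ U t') • schurMk _ (tprod ℂ fun c => e c.1.1) := by
  set k := lam.colLen 0 with hkdef
  have hk : ∀ c : lam.cells, c.1.1 < k := row_lt_colLen_zero lam
  have hk' : ∀ c : (tilde lam n h).cells, c.1.1 < k + 1 := fun c => by
    obtain ⟨d | j, rfl⟩ := (splitCells h).surjective c
    · simpa using hk d
    · simp
  have key : ∀ s : Fin k → ℂ,
      ∑ x : (tilde lam n h).cells → Fin (k + 1),
        (∏ i : Fin k, s i ^ (Finset.univ.filter fun c => x c = i.succ).card) •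
          (pair _ (fun c => extFunctionals hone hU 1 0 ξ (x c)) t •
            φ (schurMk _ (tprod ℂ fun c => consOne one e (x c)))) =
      ∑ x : lam.cells → Fin k, (∏ i, s i ^ (Finset.univ.filter fun c => x c = i).card) •
        (pair _ (fun c => ξ (x c)) t' • schurMk _ (tprod ℂ fun c => e (x c))) := by
    intro s
    have hB : ∑ i : Fin k, s i • (ξ i).smulRight (e i) =
        (Fintype.linearCombination ℂ fun i : Fin k => s i • e i) ∘ₗ
          LinearMap.pi fun i : Fin k => ξ i := by
      ext u
      simp [LinearMap.sum_apply, Fintype.linearCombination_apply, smul_smul, mul_comm]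
    have h1 := commute_finite_rank hone hU h hφ (Fintype.linearCombination ℂ fun i : Fin k => s i • e i)
      (LinearMap.pi fun i : Fin k => ξ i) (schurMk _ t)
    rw [← hB, ht, extOne_sum, schurMap_schurMk, schurMap_schurMk, tensMap_sum_smulRight,
      tensMap_sum_smulRight] at h1
    simp only [map_sum, map_smul, Fin.prod_univ_succ, Fin.cons_zero, Fin.cons_succ, one_pow,
      one_mul] at h1
    exact h1
  have h2 := sum_coeff_eq_of_forall_eval (N := schur lam U) _ _ _ _ key
    fun i : Fin k => (Finset.univ.filter fun c : lam.cells => c.1.1 = i).card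
  have h3 := congrArg φ
    (sum_content_schurMk _ hk' (extFunctionals hone hU 1 0 ξ) (consOne one e) t)
  have h4 := sum_content_schurMk _ hk ξ e t'
  rw [map_smul, map_sum] at h3
  rw [← h3, ← h4]
  simp only [map_smul]
  refine Eq.trans (Finset.sum_congr ?_ fun _ _ => rfl)
    (h2.trans (Finset.sum_congr ?_ fun _ _ => rfl))
  · exact Finset.filter_congr fun x _ => (content_tilde_iff h hk x).symm
  · exact Finset.filter_congr fun x _ => funext_iff

variable (lam) in
/-- The normalized homomorphism as a homomorphism of representations. -/
def toEHom : (schurRep one (tilde lam n h)).IntertwiningMap (ERep lam hone hU) where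
  toLinearMap := toE hone hU h
  isIntertwining' g := LinearMap.ext fun y => toE_equivariant hone hU h g y

/-- Every homomorphism `𝕊^{λ̃(n)} V → E_λ` is a multiple of the normalized one. -/
lemma exists_eq_smul_toEHom
    (g : (schurRep one (tilde lam n h)).IntertwiningMap (ERep lam hone hU)) :
    ∃ a : ℂ, g = a • toEHom hone hU lam h := by
  rcases lt_or_ge (Module.rank ℂ U) (lam.colLen 0 : Cardinal) with hr | hr
  · have := schur_subsingleton lam hr
    exact ⟨0, Representation.IntertwiningMap.ext (LinearMap.ext fun y => Subsingleton.elim _ _)⟩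
  obtain ⟨e, he⟩ := exists_highestWeight_ne_zero lam hr
  set v := schurMk lam (tprod ℂ fun c => e c.1.1) with hv
  obtain ⟨ξ₀, hξ₀⟩ : ∃ ξ₀, rowPair lam ξ₀ (v : Tens lam U) ≠ 0 := by
    by_contra hno
    push Not at hno
    exact he (schur_eq_zero_of_forall_rowPair lam hno)
  let φ : schur (tilde lam n h) V →ₗ[ℂ] schur lam U := evalTens 0 (schur lam U) ∘ₗ g.toLinearMap
  have hφ : ∀ (A : U ≃ₗ[ℂ] U) y,
      φ (schurMap _ (extOne hone hU A) y) = schurMap lam (A : U →ₗ[ℂ] U) (φ y) := fun A y =>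
    (congrArg (evalTens 0 (schur lam U)) (g.isIntertwining _ _ (glAut hone hU A) y)).trans
      (evalTens_zero_glAut hone hU A (g y))
  set u := rowPair lam ξ₀ (φ (schurMk _ (tprod ℂ fun c => consOne one e c.1.1)) : Tens lam U)
    with hu
  let a : ℂ := (rowGroup lam).card * (n - lam.card).factorial * u *
    ((rowGroup (tilde lam n h)).card : ℂ)⁻¹ * (rowPair lam ξ₀ (v : Tens lam U))⁻¹
  refine ⟨a, eq_of_evalTens_zero_eq hone hU _ _ fun y => ?_⟩
  change φ y = evalTens 0 (schur lam U) (a • toE hone hU h y)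
  rw [map_smul, ← sub_eq_zero]
  refine schur_eq_zero_of_forall_rowPair lam fun ξ => ?_
  rw [Submodule.coe_sub, Submodule.coe_smul, map_sub, map_smul, sub_eq_zero]
  obtain ⟨t, rfl⟩ := schurMk_surjective _ y
  obtain ⟨t', ht'⟩ := schurMk_surjective _ (φ (schurMk _ t))
  have h1 := congrArg (fun y : schur lam U => rowPair lam ξ₀ (y : Tens lam U))
    (rowPair_smul_highestWeight hone hU h hφ ξ e t t' ht'.symm)
  simp only [Submodule.coe_smul, map_smul, smul_eq_mul] at h1
  rw [← hv, ← hu] at h1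
  have h2 := rowPair_extFunctionals_schur hone hU h 1 0 ξ (schurMk _ t)
  rw [rowPair_schurMk, one_pow, one_mul, smul_eq_mul] at h2
  rw [← ht', rowPair_schurMk, smul_eq_mul, smul_eq_mul]
  have hR := rowGroup_card_ne_zero (tilde lam n h)
  have h3 : rowPair lam ξ (colAnti lam U t') =
      rowPair _ (extFunctionals hone hU 1 0 ξ) (colAnti _ V t) * u *
        (rowPair lam ξ₀ (v : Tens lam U))⁻¹ := by
    rw [h1, mul_inv_cancel_right₀ hξ₀]
  have h4 : rowPair _ (extFunctionals hone hU 1 0 ξ) (colAnti _ V t) =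
      ((rowGroup (tilde lam n h)).card : ℂ)⁻¹ * ((n - lam.card).factorial *
        rowPair lam ξ (evalTens 0 (schur lam U) (toE hone hU h (schurMk _ t)) : Tens lam U)) := by
    rw [← h2, inv_mul_cancel_left₀ hR]
  rw [h3, h4]
  simp only [a]
  ring

end Uniqueness

/-! ### The direct limit -/

section Limit

variable {V : Type*} [AddCommGroup V] [Module ℂ V] {one : V} (hone : one ≠ 0)
variable {U : Submodule ℂ V} (hU : IsCompl (ℂ ∙ one) U)
variable (lam : YoungDiagram)

lemma toE_levelMap (i j : ℕ) (hij : i ≤ j) (y : level V lam i) :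
    toE hone hU (level_le lam j) (levelMap one lam i j hij y) = toE hone hU (level_le lam i) y := by
  induction j, hij using Nat.le_induction with
  | base => rw [levelMap_self, LinearMap.id_apply]
  | succ j hij ih =>
    rw [levelMap_succ one lam i j hij, ← ih]
    exact toE_stab hone hU (level_le lam j) _

/-- The map `𝕊^{λ,∞} V → E_λ` induced by the normalized homomorphisms. -/
def infToE : SchurInf one lam →ₗ[ℂ] ESpace lam U :=
  Module.DirectLimit.lift ℂ ℕ (level V lam) (levelMap one lam)
    (fun k => toE hone hU (level_le lam k)) (toE_levelMap hone hU lam)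

lemma infToE_toInf (k : ℕ) (y : level V lam k) :
    infToE hone hU lam (toInf one lam k y) = toE hone hU (level_le lam k) y :=
  Module.DirectLimit.lift_of _ _ _

lemma infToE_injective : Function.Injective (infToE hone hU lam) :=
  Module.DirectLimit.lift_injective _ _ fun k => toE_injective hone hU (level_le lam k)

/-- The image of `𝕊^{λ,∞} V` in `E_λ` contains `1 ⊗ 𝕊^λ U`, and by `toE_schurProj` it is closed under
multiplication by elements of `U`. -/
lemma infToE_surjective : Function.Surjective (infToE hone hU lam) := by
  have hmul : ∀ p : SymmetricAlgebra ℂ U, ∀ z ∈ LinearMap.range (infToE hone hU lam),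
      (LinearMap.mulLeft ℂ p).rTensor (schur lam U) z ∈ LinearMap.range (infToE hone hU lam) := by
    intro p
    induction p using SymmetricAlgebra.induction with
    | algebraMap r =>
      intro z hz
      have h1 : LinearMap.mulLeft ℂ (algebraMap ℂ (SymmetricAlgebra ℂ U) r) =
          r • LinearMap.id := by
        ext q
        simp [Algebra.smul_def]
      rw [h1, LinearMap.rTensor_smul, LinearMap.rTensor_id]
      exact Submodule.smul_mem _ r hz
    | ι u =>
      rintro _ ⟨x, rfl⟩
      obtain ⟨k, y, rfl⟩ := Module.DirectLimit.exists_of x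
      refine ⟨toInf one lam (k + 1) (schurProj (level_le lam k) (y ⊗ₜ (u : V))), ?_⟩
      rw [infToE_toInf]
      refine (toE_schurProj hone hU (level_le lam k) y u).trans ?_
      rw [toSym_coe]
      exact congrArg _ (infToE_toInf hone hU lam k y).symm
    | mul a b ha hb =>
      intro z hz
      rw [LinearMap.mulLeft_mul, LinearMap.rTensor_comp, LinearMap.comp_apply]
      exact ha _ (hb z hz)
    | add a b ha hb =>
      intro z hz
      have h1 : LinearMap.mulLeft ℂ (a + b) = LinearMap.mulLeft ℂ a + LinearMap.mulLeft ℂ b := by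
        ext q
        simp [add_mul]
      rw [h1, LinearMap.rTensor_add]
      exact Submodule.add_mem _ (ha z hz) (hb z hz)
  have hone_tmul : ∀ y : schur lam U,
      (1 : SymmetricAlgebra ℂ U) ⊗ₜ[ℂ] y ∈ LinearMap.range (infToE hone hU lam) := by
    intro y
    obtain ⟨t, rfl⟩ := schurMk_surjective lam y
    induction t using PiTensorProduct.induction_on with
    | smul_tprod a w =>
      rw [map_smul, TensorProduct.tmul_smul]
      refine Submodule.smul_mem _ a ⟨toInf one lam 0 (schurMk _ (tprod ℂ
        (withOnes one (level_le lam 0) w))), ?_⟩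
      rw [infToE_toInf]
      exact toE_normalized hone hU (level_le lam 0) w
    | add a b ha hb =>
      rw [map_add, TensorProduct.tmul_add]
      exact Submodule.add_mem _ ha hb
  intro z
  change z ∈ LinearMap.range (infToE hone hU lam)
  induction z using TensorProduct.induction_on with
  | zero => exact Submodule.zero_mem _
  | add a b ha hb => exact Submodule.add_mem _ ha hb
  | tmul p y => simpa using hmul p _ (hone_tmul y)

/-- The canonical isomorphism `𝕊^{λ,∞} V ≅ E_λ`. -/
def infEquiv : (infRep one lam).Equiv (ERep lam hone hU) :=
  Representation.Equiv.mk
    (LinearEquiv.ofBijective (infToE hone hU lam)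
      ⟨infToE_injective hone hU lam, infToE_surjective hone hU lam⟩) fun g => by
    apply Module.DirectLimit.hom_ext
    intro k
    ext y
    change infToE hone hU lam (infRep one lam g (toInf one lam k y)) =
      ERep lam hone hU g (infToE hone hU lam (toInf one lam k y))
    have h1 : infRep one lam g (toInf one lam k y) = toInf one lam k (schurRep one _ g y) :=
      Module.DirectLimit.map_apply_of (fun _ => schurRep one _ g)
        (fun i j hij => levelMap_equivariant one lam g i j hij) y
    rw [h1, infToE_toInf, infToE_toInf, toE_equivariant]

lemma infEquiv_toInf (k : ℕ) (y : level V lam k) :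
    infEquiv hone hU lam (toInf one lam k y) = toE hone hU (level_le lam k) y :=
  infToE_toInf hone hU lam k y

end Limit

/-! ### Uniqueness of normalized homomorphisms -/

section Normalized

variable {V : Type*} [AddCommGroup V] [Module ℂ V] {one : V} (hone : one ≠ 0)
variable {U : Submodule ℂ V} (hU : IsCompl (ℂ ∙ one) U)
variable {lam : YoungDiagram} {n : ℕ} (h : lam.card + lam.rowLen 0 ≤ n)

lemma smul_left_cancel_of_ne_zero {N : Type*} [AddCommMonoid N] [Module ℂ N] {x : N} (hx : x ≠ 0)
    {a b : ℂ} (hab : a • x = b • x) : a = b := by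
  by_contra hne
  have h0 : (a - b) • x = 0 := by
    rw [sub_eq_add_neg, add_smul, hab, ← add_smul, add_neg_cancel, zero_smul]
  apply hx
  rw [← inv_smul_smul₀ (sub_ne_zero.2 hne) x, h0, smul_zero]

/-- If `λ` has at most `dim U` rows, then a normalized map is nonzero. -/
lemma IsNormalized.exists_apply_ne_zero (hr : (lam.colLen 0 : Cardinal) ≤ Module.rank ℂ U)
    {f : schur (tilde lam n h) V →ₗ[ℂ] ESpace lam U} (hf : IsNormalized one h f) :
    ∃ y, f y ≠ 0 := by
  obtain ⟨e, he⟩ := exists_highestWeight_ne_zero lam hr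
  refine ⟨schurMk _ (tprod ℂ (withOnes one h fun c => e c.1.1)), fun h0 => he ?_⟩
  have h1 := congrArg (evalTens 0 (schur lam U)) ((hf fun c => e c.1.1).symm.trans h0)
  rwa [evalTens_tmul, map_one, one_smul, map_zero] at h1

lemma eq_toEHom_of_isNormalized
    (g : (schurRep one (tilde lam n h)).IntertwiningMap (ERep lam hone hU))
    (hg : IsNormalized one h g.toLinearMap) : g = toEHom hone hU lam h := by
  rcases lt_or_ge (Module.rank ℂ U) (lam.colLen 0 : Cardinal) with hr | hr
  · have := schur_subsingleton lam hr
    exact Representation.IntertwiningMap.ext (LinearMap.ext fun y => Subsingleton.elim _ _)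
  obtain ⟨a, rfl⟩ := exists_eq_smul_toEHom hone hU h g
  obtain ⟨e, he⟩ := exists_highestWeight_ne_zero lam hr
  have h1 : a • toE hone hU h (schurMk _ (tprod ℂ (withOnes one h fun c => e c.1.1))) =
      1 ⊗ₜ[ℂ] schurMk lam (tprod ℂ fun c => e c.1.1) := hg fun c => e c.1.1
  rw [toE_normalized hone hU h] at h1
  have h2 := congrArg (evalTens 0 (schur lam U)) h1
  rw [map_smul, evalTens_tmul, map_one, one_smul] at h2
  rw [smul_left_cancel_of_ne_zero he (h2.trans (one_smul _ _).symm), one_smul]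

variable (one lam) in
/-- The canonical map `𝕊^{λ̃(n)} V → 𝕊^{λ,∞} V` as a homomorphism of representations. -/
def toInfHom (k : ℕ) :
    (schurRep one (tilde lam _ (level_le lam k))).IntertwiningMap (infRep one lam) where
  toLinearMap := toInf one lam k
  isIntertwining' g := LinearMap.ext fun y =>
    (Module.DirectLimit.map_apply_of (fun _ => schurRep one _ g)
      (fun i j hij => levelMap_equivariant one lam g i j hij) y).symm

lemma eq_infEquiv_of_isNormalized (F : (infRep one lam).IntertwiningMap (ERep lam hone hU))
    (hF : ∀ k, IsNormalized one (level_le lam k) (F.toLinearMap ∘ₗ toInf one lam k))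
    (x : SchurInf one lam) : F x = infEquiv hone hU lam x := by
  obtain ⟨k, y, rfl⟩ := Module.DirectLimit.exists_of x
  have h1 := eq_toEHom_of_isNormalized hone hU (level_le lam k) (F.comp (toInfHom one lam k)) (hF k)
  have h2 : F (toInf one lam k y) = toE hone hU (level_le lam k) y :=
    congrArg (fun f : (schurRep one (tilde lam _ (level_le lam k))).IntertwiningMap
      (ERep lam hone hU) => f y) h1
  exact h2.trans (infEquiv_toInf hone hU lam k y).symm

lemma exists_eq_smul_infEquiv (G : (infRep one lam).IntertwiningMap (ERep lam hone hU)) :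
    ∃ a : ℂ, G = a • (infEquiv hone hU lam).toIntertwiningMap := by
  rcases lt_or_ge (Module.rank ℂ U) (lam.colLen 0 : Cardinal) with hr | hr
  · have := schur_subsingleton lam hr
    exact ⟨0, Representation.IntertwiningMap.ext (LinearMap.ext fun y => Subsingleton.elim _ _)⟩
  have hk : ∀ k, ∃ a : ℂ, ∀ y, G (toInf one lam k y) = a • toE hone hU (level_le lam k) y := by
    intro k
    obtain ⟨a, ha⟩ := exists_eq_smul_toEHom hone hU (level_le lam k) (G.comp (toInfHom one lam k))
    exact ⟨a, fun y => congrArg (fun f : (schurRep one (tilde lam _ (level_le lam k))).IntertwiningMap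
      (ERep lam hone hU) => f y) ha⟩
  choose a ha using hk
  obtain ⟨y₀, hy₀⟩ :=
    (toE_normalized hone hU (level_le lam 0)).exists_apply_ne_zero (level_le lam 0) hr
  -- The scalars at all levels agree, as can be seen on the images of `y₀`.
  have hconst : ∀ k, a k = a 0 := by
    intro k
    have h1 : toInf one lam k (levelMap one lam 0 k (Nat.zero_le k) y₀) = toInf one lam 0 y₀ :=
      Module.DirectLimit.of_f
    have h2 := ha k (levelMap one lam 0 k (Nat.zero_le k) y₀)
    rw [h1, ha 0, toE_levelMap] at h2
    exact smul_left_cancel_of_ne_zero hy₀ h2.symm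
  refine ⟨a 0, Representation.IntertwiningMap.ext (LinearMap.ext fun x => ?_)⟩
  obtain ⟨k, y, rfl⟩ := Module.DirectLimit.exists_of x
  change G (toInf one lam k y) = a 0 • infEquiv hone hU lam (toInf one lam k y)
  rw [ha, hconst, infEquiv_toInf]

lemma le_rank_complement {V : Type*} [AddCommGroup V] [Module ℂ V] {one : V} (hone : one ≠ 0)
    {U : Submodule ℂ V} (hU : IsCompl (ℂ ∙ one) U) {k : ℕ} (hk : ((k + 1 : ℕ) : Cardinal) ≤ Module.rank ℂ V) :
    (k : Cardinal) ≤ Module.rank ℂ U := by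
  have h1 := (Submodule.prodEquivOfIsCompl _ _ hU).rank_eq
  have h2 := (LinearEquiv.toSpanNonzeroSingleton ℂ V one hone).lift_rank_eq
  rw [rank_self, Cardinal.lift_one, Cardinal.lift_uzero] at h2
  rw [rank_prod', ← h2] at h1
  rw [← h1, Nat.cast_add, Nat.cast_one, add_comm (1 : Cardinal)] at hk
  exact (Cardinal.add_le_add_iff_of_lt_aleph0 Cardinal.one_lt_aleph0).1 hk

end Normalized

end UnitalSchur

end

open scoped TensorProduct
open UnitalSchur
theorem mainTheorem5 {V : Type*} [AddCommGroup V] [Module ℂ V] (one : V) (hone : one ≠ 0)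
    (U : Submodule ℂ V) (hU : IsCompl (ℂ ∙ one) U) (lam : YoungDiagram) :
    -- existence of a nonzero homomorphism, unique up to scaling
    (((lam.colLen 0 + 1 : ℕ) : Cardinal) ≤ Module.rank ℂ V →
      ∀ (n : ℕ) (h : lam.card + lam.rowLen 0 ≤ n),
        ∃ f : (schurRep one (tilde lam n h)).IntertwiningMap (ERep lam hone hU),
          f ≠ 0 ∧ ∀ g : (schurRep one (tilde lam n h)).IntertwiningMap (ERep lam hone hU),
            ∃ a : ℂ, g = a • f) ∧
    -- every nonzero homomorphism is injective
    (∀ (n : ℕ) (h : lam.card + lam.rowLen 0 ≤ n)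
      (f : (schurRep one (tilde lam n h)).IntertwiningMap (ERep lam hone hU)),
      f ≠ 0 → Function.Injective f) ∧
    -- the stabilization maps are injective
    (∀ (n : ℕ) (h : lam.card + lam.rowLen 0 ≤ n), Function.Injective (stab h one)) ∧
    -- the normalized homomorphisms and the canonical isomorphism of the limit with `E_λ`
    (∃ f : ∀ (n : ℕ) (h : lam.card + lam.rowLen 0 ≤ n),
        (schurRep one (tilde lam n h)).IntertwiningMap (ERep lam hone hU),
      (∀ n h, IsNormalized one h (f n h).toLinearMap ∧ Function.Injective (f n h) ∧
        ∀ g : (schurRep one (tilde lam n h)).IntertwiningMap (ERep lam hone hU),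
          IsNormalized one h g.toLinearMap → g = f n h) ∧
      (∀ n h y, f (n + 1) (Nat.le_succ_of_le h) (stab h one y) = f n h y) ∧
      ∃ F : (infRep one lam).Equiv (ERep lam hone hU),
        (∀ k y, F (toInf one lam k y) = f _ (level_le lam k) y) ∧
        ∀ G : (infRep one lam).IntertwiningMap (ERep lam hone hU),
          ∃ a : ℂ, G = a • F.toIntertwiningMap) ∧
    -- `E_λ` does not depend on the splitting
    (∀ (U' : Submodule ℂ V) (hU' : IsCompl (ℂ ∙ one) U'),
      ∃ T : (ERep lam hone hU).Equiv (ERep lam hone hU'),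
        ∀ (F : (infRep one lam).Equiv (ERep lam hone hU))
          (F' : (infRep one lam).Equiv (ERep lam hone hU')),
          (∀ k, IsNormalized one (level_le lam k) (F.toLinearMap ∘ₗ toInf one lam k)) →
          (∀ k, IsNormalized one (level_le lam k) (F'.toLinearMap ∘ₗ toInf one lam k)) →
          ∀ x, T (F x) = F' x) := by
  refine ⟨fun hr n h => ⟨toEHom hone hU lam h, fun h0 => ?_, exists_eq_smul_toEHom hone hU h⟩,
    fun n h f hf => ?_, fun n h => stab_injective h hone,
    ⟨fun n h => toEHom hone hU lam h, fun n h => ⟨toE_normalized hone hU h,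
      toE_injective hone hU h, eq_toEHom_of_isNormalized hone hU h⟩, fun n h => toE_stab hone hU h,
      infEquiv hone hU lam, infEquiv_toInf hone hU lam, exists_eq_smul_infEquiv hone hU⟩,
    fun U' hU' => ⟨(infEquiv hone hU lam).symm.trans (infEquiv hone hU' lam),
      fun F F' hF hF' x => ?_⟩⟩
  · obtain ⟨y, hy⟩ := (toE_normalized hone hU h).exists_apply_ne_zero h
      (le_rank_complement hone hU hr)
    exact hy (congrArg (fun f : (schurRep one (tilde lam n h)).IntertwiningMap
      (ERep lam hone hU) => f y) h0)
  · obtain ⟨a, rfl⟩ := exists_eq_smul_toEHom hone hU h f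
    have ha : a ≠ 0 := by
      rintro rfl
      exact hf (zero_smul _ _)
    intro y y' he
    have h1 : a • toE hone hU h y = a • toE hone hU h y' := he
    exact toE_injective hone hU h (by
      rw [← inv_smul_smul₀ ha (toE hone hU h y), h1, inv_smul_smul₀ ha])
  · have h1 : F x = infEquiv hone hU lam x :=
      eq_infEquiv_of_isNormalized hone hU F.toIntertwiningMap hF x
    have h2 : F' x = infEquiv hone hU' lam x :=
      eq_infEquiv_of_isNormalized hone hU' F'.toIntertwiningMap hF' x
    rw [h1, h2, Representation.Equiv.trans_apply, Representation.Equiv.symm_apply_apply]
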